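/- Let $H\le \mathrm{GL}(d,\mathbb R)$ be a closed subgroup with left Haar measure $\mathrm dh$, and let $\xi_0\in\mathbb R^d$ be such that the orbit $\mathcal O=H^T\xi_0=\{h^T\xi_0 : h\in H\}$ is open and the stabilizer $\{h\in H : h^T\xi_0=\xi_0\}$ is compact. Let $V$ be a nonempty open set whose closure is a compact subset of $\mathcal O$. Notation. $|\cdot|$ is the Euclidean norm on $\mathbb R^d$ and $\|h\|$ the corresponding operator norm; $\widehat f(\xi)=\int f(x)e^{-2\pi i\langle x,\xi\rangle}\,\mathrm dx$. A $\xi$-neighborhood is a relatively open subset of the unit sphere $S^{d-1}$ containing $\xi$. For $W\subset S^{d-1}$ and $R>0$ put $C(W)=\{\eta\ne 0 : \eta/|\eta|\in W\}$ and $C(W,R)=\{\eta\in C(W) : |\eta|>R\}$, and for open $W\subset S^{d-1}\cap\mathcal O$ $$K_i(W,V,R)=\{h\in H : h^{-T}V\subset C(W,R)\},\qquad K_o(W,V,R)=\{h\in H : h^{-T}V\cap C(W,R)\neq\emptyset\}.$$ For $\psi\in\mathcal S(\mathbb R^d)$ and $u\in\mathcal S'(\mathbb R^d)$ the wavelet transform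 is $W_\psi u(y,h)=u\big(\overline{\pi(y,h)\psi}\big)$, where $[\pi(y,h)\psi](z)=|\det h|^{-1/2}\psi(h^{-1}(z-y))$. The function $\psi$ is admissible if $\int_H|\widehat\psi(h^T\xi)|^2\,\mathrm dh=1$ for all $\xi\in\mathcal O$. A pair $(x,\xi)\in\mathbb R^d\times S^{d-1}$ is a regular directed point of $u$ if there are $\varphi\in C_c^\infty(\mathbb R^d)$, identically one in a neighborhood of $x$, and a $\xi$-neighborhood $W\subset S^{d-1}$ such that for every $N\in\mathbb N$ there is $C_N>0$ with $|\widehat{\varphi u}(\xi')|\le C_N(1+|\xi'|)^{-N}$ for all $\xi'\in C(W)$. Assume that for some $\xi_1\in\mathcal O\cap S^{d-1}$ the following hold: 1. ($V$-cone approximation property at $\xi_1$) for every $\xi_1$-neighborhood $W\subset S^{d-1}\cap\mathcal O$ and every $R>0$ there are a $\xi_1$-neighborhood $W'\subset S^{d-1}\cap\mathcal O$ and $R'>0$ with $K_o(W',V,R')\subset K_i(W,V,R)$; 2. (inverse-norm estimate at $\xi_1$) there are a $\xi_1$-neighborhood $W_0\subset S^{d-1}\cap\mathcal O$ and $R_0,\alpha_1,C>0$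 with $\|h^{-1}\|\le C\|h\|^{-\alpha_1}$ for all $h\in K_o(W_0,V,R_0)$. Then for every admissible $\psi\in\mathcal S(\mathbb R^d)$ with $\operatorname{supp}\widehat\psi\subset V$, every $u\in\mathcal S'(\mathbb R^d)$ and every $(x,\xi)\in\mathbb R^d\times(\mathcal O\cap S^{d-1})$, the following are equivalent: (i) $(x,\xi)$ is a regular directed point of $u$; (ii) there are a neighborhood $U$ of $x$, some $R>0$ and a $\xi$-neighborhood $W\subset S^{d-1}\cap\mathcal O$ such that $$\forall N\in\mathbb N\ \exists C_N>0\ \forall y\in U\ \forall h\in K_o(W,V,R):\quad |W_\psi u(y,h)|\le C_N\|h\|^N .$$ -/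

import Mathlib

open MeasureTheory Topology
open scoped SchwartzMap FourierTransform ContDiff

noncomputable section

namespace DilationWavelet

/-- `ℝ^d` with its Euclidean norm. -/
abbrev Euc (d : ℕ) : Type := EuclideanSpace ℝ (Fin d)

/-- `GL(ℝ^d)` as a group of matrices. -/
abbrev MatGL (d : ℕ) : Type := Matrix.GeneralLinearGroup (Fin d) ℝ

variable {d : ℕ}

/-! ### Matrices acting on `ℝ^d` -/

/-- The operator norm `‖h‖` with respect to the Euclidean norm. -/
def opNorm (h : MatGL d) : ℝ :=
  ‖Matrix.toEuclideanCLM (n := Fin d) (𝕜 := ℝ) (h : Matrix (Fin d) (Fin d) ℝ)‖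

/-- The invertible linear map `v ↦ h v` of `ℝ^d`. -/
def linEquiv (h : MatGL d) : Euc d ≃L[ℝ] Euc d :=
  ContinuousLinearEquiv.unitsEquiv ℝ (Euc d)
    (Units.map
      ((Matrix.toEuclideanCLM (n := Fin d) (𝕜 := ℝ) :
        Matrix (Fin d) (Fin d) ℝ →* (Euc d →L[ℝ] Euc d))) h)

theorem linEquiv_apply (h : MatGL d) (v : Euc d) :
    linEquiv h v =
      Matrix.toEuclideanCLM (n := Fin d) (𝕜 := ℝ) (h : Matrix (Fin d) (Fin d) ℝ) v := rfl

/-- The dual action `(h, ξ) ↦ hᵀ ξ`. -/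
def dualAct (h : MatGL d) (ξ : Euc d) : Euc d :=
  Matrix.toEuclideanCLM (n := Fin d) (𝕜 := ℝ) (h : Matrix (Fin d) (Fin d) ℝ).transpose ξ

/-- The orbit `Hᵀ ξ₀ = {hᵀ ξ₀ | h ∈ H}` of the dual action. -/
def dualOrbit (H : Subgroup (MatGL d)) (ξ₀ : Euc d) : Set (Euc d) :=
  {ξ | ∃ h ∈ H, dualAct h ξ₀ = ξ}

/-- The stabilizer `H_{ξ₀} = {h ∈ H | hᵀ ξ₀ = ξ₀}` of the dual action, as a subset of `H`. -/
def dualStabilizer (H : Subgroup (MatGL d)) (ξ₀ : Euc d) : Set H :=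
  {h | dualAct (h : MatGL d) ξ₀ = ξ₀}

/-- `V ⋐ O`: both sets are open, and the closure of `V` is a compact subset of `O`. -/
def CompactlyInside (V O : Set (Euc d)) : Prop :=
  IsOpen V ∧ IsOpen O ∧ IsCompact (closure V) ∧ closure V ⊆ O

/-! ### Directions and cones -/

/-- `W` is a neighborhood of `ξ` in the unit sphere: a relatively open subset of the sphere
containing `ξ`. -/
def IsDirNhd (ξ : Euc d) (W : Set (Euc d)) : Prop :=
  ξ ∈ W ∧ ∃ A : Set (Euc d), IsOpen A ∧ W = A ∩ Metric.sphere 0 1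

/-- The cone `C(W) = {η ≠ 0 | η / |η| ∈ W}`. -/
def cone (W : Set (Euc d)) : Set (Euc d) :=
  {η | η ≠ 0 ∧ ‖η‖⁻¹ • η ∈ W}

/-- The truncated cone `C(W, R)`, i.e. `C(W)` without the closed ball of radius `R` around `0`. -/
def truncCone (W : Set (Euc d)) (R : ℝ) : Set (Euc d) :=
  cone W \ Metric.closedBall 0 R

/-- The inner cone-affiliated set `K_i(W, V, R) = {h ∈ H | h⁻ᵀ V ⊆ C(W, R)}`. -/
def innerK (H : Subgroup (MatGL d)) (W V : Set (Euc d)) (R : ℝ) : Set H :=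
  {h | dualAct (h : MatGL d)⁻¹ '' V ⊆ truncCone W R}

/-- The outer cone-affiliated set `K_o(W, V, R) = {h ∈ H | h⁻ᵀ V ∩ C(W, R) ≠ ∅}`. -/
def outerK (H : Subgroup (MatGL d)) (W V : Set (Euc d)) (R : ℝ) : Set H :=
  {h | (dualAct (h : MatGL d)⁻¹ '' V ∩ truncCone W R).Nonempty}

/-- The (strong) `V`-cone approximation property at `ξ` of the dual action of `H` on `O`. -/
def ConeApproximation (H : Subgroup (MatGL d)) (O V : Set (Euc d)) (ξ : Euc d) : Prop :=
  ∀ W : Set (Euc d), IsDirNhd ξ W → W ⊆ O → ∀ R : ℝ, 0 < R →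
    ∃ R' : ℝ, 0 < R' ∧ ∃ W' : Set (Euc d), IsDirNhd ξ W' ∧ W' ⊆ O ∧
      outerK H W' V R' ⊆ innerK H W V R

/-- The inverse-norm estimate (the first of the two conditions of `V`-microlocal admissibility) in
direction `ξ`: `‖h⁻¹‖ ≤ C ‖h‖ ^ (-α)` on some `K_o(W₀, V, R₀)`. -/
def InverseNormEstimate (H : Subgroup (MatGL d)) (O V : Set (Euc d)) (ξ : Euc d) : Prop :=
  ∃ W₀ : Set (Euc d), IsDirNhd ξ W₀ ∧ W₀ ⊆ O ∧ ∃ R₀ : ℝ, 0 < R₀ ∧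
    ∃ α : ℝ, 0 < α ∧ ∃ C : ℝ, 0 < C ∧ ∀ h ∈ outerK H W₀ V R₀,
      opNorm (h : MatGL d)⁻¹ ≤ C * opNorm (h : MatGL d) ^ (-α)

/-! ### The wavelet transform -/

/-- The quasi-regular representation on Schwartz functions,
`(π(x,h) f)(y) = |det h| ^ (-1/2) f(h⁻¹ (y - x))`. -/
def quasiRegular (x : Euc d) (h : MatGL d) (f : 𝓢(Euc d, ℂ)) : 𝓢(Euc d, ℂ) :=
  ((|(h : Matrix (Fin d) (Fin d) ℝ).det| ^ (-(1 / 2) : ℝ) : ℝ) : ℂ) •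
    SchwartzMap.compSubConstCLM ℂ x
      (SchwartzMap.compCLMOfContinuousLinearEquiv ℂ (linEquiv h⁻¹) f)

theorem quasiRegular_apply (x : Euc d) (h : MatGL d) (f : 𝓢(Euc d, ℂ)) (y : Euc d) :
    quasiRegular x h f y =
      ((|(h : Matrix (Fin d) (Fin d) ℝ).det| ^ (-(1 / 2) : ℝ) : ℝ) : ℂ) *
        f (linEquiv h⁻¹ (y - x)) := by
  simp [quasiRegular]

/-- The complex conjugate of a Schwartz function. -/
def conjS (f : 𝓢(Euc d, ℂ)) : 𝓢(Euc d, ℂ) :=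
  SchwartzMap.postcompCLM (𝕜 := ℝ) (Complex.conjCLE : ℂ →L[ℝ] ℂ) f

theorem conjS_apply (f : 𝓢(Euc d, ℂ)) (y : Euc d) :
    conjS f y = (starRingEnd ℂ) (f y) := by
  simp [conjS]

/-- The wavelet transform `(W_ψ u)(x,h) = ⟨u | π(x,h) ψ⟩`, where `⟨u | φ⟩ = u(conj φ)` extends the
`L²` scalar product. -/
def waveletTransform (ψ : 𝓢(Euc d, ℂ)) (u : 𝓢'(Euc d, ℂ)) (x : Euc d) (h : MatGL d) : ℂ :=
  u (conjS (quasiRegular x h ψ))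

/-- The admissibility condition `∫_H |ψ̂(hᵀ ξ)|² dh = 1` for all `ξ ∈ O`, where `μ` is the left Haar
measure of `H`. -/
def Admissible (H : Subgroup (MatGL d)) [MeasurableSpace H] (μ : Measure H)
    (O : Set (Euc d)) (ψ : 𝓢(Euc d, ℂ)) : Prop :=
  ∀ ξ ∈ O, ∫ h : H, ‖(𝓕 ψ) (dualAct (h : MatGL d) ξ)‖ ^ 2 ∂μ = 1

/-! ### Regular directed points -/

/-- The tempered distribution `T` is (given by integration against) the continuous function `f`.
Such an `f` is unique. -/
def IsContinuousFunction (T : 𝓢'(Euc d, ℂ)) (f : Euc d → ℂ) : Prop :=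
  Continuous f ∧ ∀ g : 𝓢(Euc d, ℂ),
    Integrable (fun η => f η * g η) volume ∧ T g = ∫ η, f η * g η

/-- `(x, ξ)` is a regular directed point of `u`: for some `φ ∈ C_c^∞(ℝ^d)` that is identically one
near `x`, the Fourier transform `F` of the compactly supported distribution `φ u` (a continuous
function) decays rapidly on the cone `C(W)` over some neighborhood `W` of `ξ` in the sphere. -/
def RegularDirectedPoint (u : 𝓢'(Euc d, ℂ)) (x ξ : Euc d) : Prop :=
  ∃ φ : Euc d → ℂ, ContDiff ℝ ∞ φ ∧ HasCompactSupport φ ∧ (∀ᶠ y in 𝓝 x, φ y = 1) ∧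
    ∃ F : Euc d → ℂ, IsContinuousFunction (𝓕 (TemperedDistribution.smulLeftCLM ℂ φ u)) F ∧
      ∃ W : Set (Euc d), IsDirNhd ξ W ∧
        ∀ N : ℕ, ∃ C : ℝ, 0 < C ∧ ∀ η ∈ cone W, ‖F η‖ ≤ C * ((1 + ‖η‖) ^ N)⁻¹

end DilationWavelet

end

/-! Both hypotheses move along the orbit: left multiplication by `g ∈ H` turns a statement at `ξ₁`
into one at any other direction (the two `transfer` lemmas). On a suitable `K_o` the inverse-norm
estimate then gives `‖h‖ ≤ B` and `‖h⁻¹‖ ‖h‖ ^ m ≤ A` (`InverseNormEstimate.exists_bounds`,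
`NormBounds`). Hence `‖h⁻¹‖` and `|det h|⁻¹` grow at most polynomially in `1 / ‖h‖`, and decay of
every order in `‖h‖` absorbs them.

(i) ⇒ (ii). Split `u = φu + (1 - φ)u`. The transform of `φu` is, up to `|det h| ^ (1/2)`, the
integral of its Fourier transform `F` against a modulation of `conj ψ̂(hᵀ ·)`, which vanishes off
`h⁻ᵀ V`. Cone approximation puts `h⁻ᵀ V` inside the cone where `F` decays, and there `|η| ≥ c /
‖h‖`, so decay in `η` is decay in `‖h‖` (`exists_waveletTransform_le_of_decay`). For `y` near `x`,
the functions `(1 - φ) π(y,h)ψ` are small in every Schwartz seminorm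
(`rapidlySmall_conjS_quasiRegular_sub`).

(ii) ⇒ (i). No integral over `H` is needed. Fix `v` with `ψ̂(v) ≠ 0`; for each large `η` in the cone
choose one `h ∈ H` with `hᵀ η = v`, so that `h ∈ K_o`. The Fourier transform of `φu` at `η` is `𝓕 u`
applied to the translate `p(· - η)` of `p = 𝓕⁻ φ`. With `f = conj ψ̂` and a local inverse `f G = Θ`,
`Θ = 1` near `v`, this translate is `f(hᵀ ·) G(hᵀ ·) p(· - η)` plus the tail `(1 - Θ(hᵀ ·)) p(· -
η)`, which is rapidly small. Now `G(hᵀ ·)` is the Fourier transform of a kernel concentrated near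
`0`. Its part far from `0` is again rapidly small, and its part near `0` expresses the pairing as a
double integral of values `W_ψ u(y, h)` with `y` near `x` (`norm_fourier_localized_le`). Finally `1
+ |η|` is at most a constant times `‖h‖ ^ (-m)`, so powers of `‖h‖` become powers of `1 + |η|`. -/

noncomputable section

namespace DilationWavelet

section Schwartz

variable {E : Type*} [NormedAddCommGroup E] [NormedSpace ℝ E]

/-! ### Seminorm estimates on Schwartz functions -/

/-- A continuous seminorm on Schwartz space is bounded by a finite sum of the standard ones. -/
theorem exists_seminorm_le_sum (q : Seminorm ℂ 𝓢(E, ℂ)) (hq : Continuous q) :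
    ∃ (n : ℕ) (C : ℝ), 0 ≤ C ∧ ∀ f : 𝓢(E, ℂ), q f ≤
      C * ∑ k ∈ Finset.range n, ∑ l ∈ Finset.range n, SchwartzMap.seminorm ℂ k l f := by
  obtain ⟨s, C, -, hC⟩ := Seminorm.bound_of_continuous (schwartz_withSeminorms ℂ E ℂ) q hq
  obtain ⟨n, hn⟩ : ∃ n : ℕ, s ⊆ Finset.range n ×ˢ Finset.range n := by
    refine ⟨s.sup (fun m => m.1 + m.2) + 1, fun m hm => ?_⟩
    have := Finset.le_sup (f := fun m : ℕ × ℕ => m.1 + m.2) hm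
    simp only [Finset.mem_product, Finset.mem_range]
    omega
  refine ⟨n, C, C.2, fun f => (hC f).trans ?_⟩
  rw [smul_apply, NNReal.smul_def, smul_eq_mul]
  refine mul_le_mul_of_nonneg_left ?_ C.2
  refine (Seminorm.finset_sup_apply_le (Finset.sum_nonneg fun k _ => Finset.sum_nonneg
    fun l _ => apply_nonneg _ _) fun i hi => ?_)
  rw [← Finset.sum_product']
  exact Finset.single_le_sum (f := fun m : ℕ × ℕ => SchwartzMap.seminorm ℂ m.1 m.2 f)
    (fun m _ => apply_nonneg _ _) (hn hi)

/-- Multiplication by a smooth function: where the multiplier does not vanish, the weight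
`1 ≤ c ‖z‖ ^ N` may be traded for decay of the Schwartz function. -/
theorem seminorm_mul_le {a : E → ℂ} {g F : 𝓢(E, ℂ)} {k l N : ℕ} {B c : ℝ} (ha : ContDiff ℝ ∞ a)
    (hF : ∀ z, F z = a z * g z) (hB : 0 ≤ B) (hc : 0 ≤ c)
    (hab : ∀ i ≤ l, ∀ z, ‖iteratedFDeriv ℝ i a z‖ ≤ B)
    (hv : ∀ z, (∀ᶠ y in 𝓝 z, a y = 0) ∨ 1 ≤ c * ‖z‖ ^ N) :
    SchwartzMap.seminorm ℂ k l F ≤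
      2 ^ l * B * c * ∑ i ∈ Finset.range (l + 1), SchwartzMap.seminorm ℂ (k + N) i g := by
  have hS : 0 ≤ ∑ i ∈ Finset.range (l + 1), SchwartzMap.seminorm ℂ (k + N) i g :=
    Finset.sum_nonneg fun i _ => apply_nonneg _ _
  have hFeq : (F : E → ℂ) = fun z => a z * g z := funext hF
  refine SchwartzMap.seminorm_le_bound ℂ k l F (by positivity) fun z => ?_
  rcases hv z with hz | hz
  · have hev : (F : E → ℂ) =ᶠ[𝓝 z] fun _ => 0 := by
      filter_upwards [hz] with y hy
      rw [hF, hy, zero_mul]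
    have h0 : iteratedFDeriv ℝ l (F : E → ℂ) z = 0 := by
      rw [(hev.iteratedFDeriv ℝ l).eq_of_nhds]
      simp
    rw [h0, norm_zero, mul_zero]
    positivity
  · have h1 : ‖iteratedFDeriv ℝ l (F : E → ℂ) z‖ ≤ ∑ i ∈ Finset.range (l + 1),
        (l.choose i : ℝ) * ‖iteratedFDeriv ℝ i a z‖ * ‖iteratedFDeriv ℝ (l - i) g z‖ := by
      rw [hFeq]
      exact norm_iteratedFDeriv_mul_le (N := ∞) ha (g.smooth ⊤) z (mod_cast le_top)
    have h2 : ∀ i ∈ Finset.range (l + 1), ‖z‖ ^ k * ((l.choose i : ℝ) * ‖iteratedFDeriv ℝ i a z‖ *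
        ‖iteratedFDeriv ℝ (l - i) g z‖) ≤ (l.choose i : ℝ) * (B * c *
          ∑ i ∈ Finset.range (l + 1), SchwartzMap.seminorm ℂ (k + N) i g) := by
      intro i hi
      have hi' : i ≤ l := Nat.lt_succ_iff.mp (Finset.mem_range.mp hi)
      have h3 : ‖z‖ ^ (k + N) * ‖iteratedFDeriv ℝ (l - i) g z‖ ≤
          ∑ i ∈ Finset.range (l + 1), SchwartzMap.seminorm ℂ (k + N) i g :=
        (SchwartzMap.le_seminorm ℂ (k + N) (l - i) g z).trans
          (Finset.single_le_sum (f := fun i => SchwartzMap.seminorm ℂ (k + N) i g)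
            (fun m _ => apply_nonneg _ _) (Finset.mem_range.mpr (by omega)))
      calc ‖z‖ ^ k * ((l.choose i : ℝ) * ‖iteratedFDeriv ℝ i a z‖ *
            ‖iteratedFDeriv ℝ (l - i) g z‖)
          = (l.choose i : ℝ) * (‖iteratedFDeriv ℝ i a z‖ *
              (1 * (‖z‖ ^ k * ‖iteratedFDeriv ℝ (l - i) g z‖))) := by ring
        _ ≤ (l.choose i : ℝ) * (B *
              ((c * ‖z‖ ^ N) * (‖z‖ ^ k * ‖iteratedFDeriv ℝ (l - i) g z‖))) := by
            gcongr
            exact hab i hi' z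
        _ = (l.choose i : ℝ) * (B * c *
              (‖z‖ ^ (k + N) * ‖iteratedFDeriv ℝ (l - i) g z‖)) := by ring
        _ ≤ _ := by gcongr
    calc ‖z‖ ^ k * ‖iteratedFDeriv ℝ l (F : E → ℂ) z‖
        ≤ ‖z‖ ^ k * ∑ i ∈ Finset.range (l + 1),
          (l.choose i : ℝ) * ‖iteratedFDeriv ℝ i a z‖ * ‖iteratedFDeriv ℝ (l - i) g z‖ := by
          gcongr
      _ ≤ ∑ i ∈ Finset.range (l + 1), (l.choose i : ℝ) * (B * c *
          ∑ i ∈ Finset.range (l + 1), SchwartzMap.seminorm ℂ (k + N) i g) := by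
          rw [Finset.mul_sum]
          exact Finset.sum_le_sum h2
      _ = _ := by
          rw [← Finset.sum_mul, ← Nat.cast_sum, Nat.sum_range_choose]
          push_cast
          ring

theorem seminorm_compSubConst_le (g : 𝓢(E, ℂ)) (y : E) (k l : ℕ) :
    SchwartzMap.seminorm ℂ k l (SchwartzMap.compSubConstCLM ℂ y g) ≤
      (1 + ‖y‖) ^ k * (2 ^ k * (SchwartzMap.seminorm ℂ 0 l g + SchwartzMap.seminorm ℂ k l g)) := by
  refine SchwartzMap.seminorm_le_bound ℂ k l _ (by positivity) fun z => ?_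
  have h0 : iteratedFDeriv ℝ l (SchwartzMap.compSubConstCLM ℂ y g : E → ℂ) z =
      iteratedFDeriv ℝ l g (z - y) := by
    rw [← iteratedFDeriv_comp_sub]
    congr 1
  rw [h0]
  have h1 : ‖z‖ ≤ (1 + ‖y‖) * (1 + ‖z - y‖) := by
    have := norm_add_le (z - y) y
    rw [sub_add_cancel] at this
    nlinarith [norm_nonneg y, norm_nonneg (z - y)]
  have h2 : (1 + ‖z - y‖) ^ k ≤ 2 ^ k * (1 + ‖z - y‖ ^ k) := by
    refine (add_pow_le zero_le_one (norm_nonneg _) k).trans ?_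
    rw [one_pow]
    gcongr
    · norm_num
    · omega
  calc ‖z‖ ^ k * ‖iteratedFDeriv ℝ l g (z - y)‖
      ≤ ((1 + ‖y‖) * (1 + ‖z - y‖)) ^ k * ‖iteratedFDeriv ℝ l g (z - y)‖ := by gcongr
    _ ≤ (1 + ‖y‖) ^ k * (2 ^ k * (1 + ‖z - y‖ ^ k)) * ‖iteratedFDeriv ℝ l g (z - y)‖ := by
        rw [mul_pow]; gcongr
    _ = (1 + ‖y‖) ^ k * (2 ^ k * (‖z - y‖ ^ 0 * ‖iteratedFDeriv ℝ l g (z - y)‖ +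
          ‖z - y‖ ^ k * ‖iteratedFDeriv ℝ l g (z - y)‖)) := by ring
    _ ≤ _ := by
        gcongr <;> exact SchwartzMap.le_seminorm ℂ _ _ _ _

theorem norm_iteratedFDeriv_comp_clm_le {f : E → ℂ} (hf : ContDiff ℝ ∞ f) (L : E →L[ℝ] E) (l : ℕ)
    (z : E) :
    ‖iteratedFDeriv ℝ l (fun z => f (L z)) z‖ ≤ ‖L‖ ^ l * ‖iteratedFDeriv ℝ l f (L z)‖ := by
  have := L.iteratedFDeriv_comp_right hf z (i := l) (mod_cast le_top)
  change ‖iteratedFDeriv ℝ l (f ∘ L) z‖ ≤ _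
  rw [this]
  refine (ContinuousMultilinearMap.norm_compContinuousLinearMap_le _ _).trans ?_
  simp [mul_comm]

theorem seminorm_compEquiv_le (g : 𝓢(E, ℂ)) (L : E ≃L[ℝ] E) (k l : ℕ) :
    SchwartzMap.seminorm ℂ k l (SchwartzMap.compCLMOfContinuousLinearEquiv ℂ L g) ≤
      ‖(L.symm : E →L[ℝ] E)‖ ^ k * ‖(L : E →L[ℝ] E)‖ ^ l * SchwartzMap.seminorm ℂ k l g := by
  refine SchwartzMap.seminorm_le_bound ℂ k l _ (by positivity) fun z => ?_
  have h1 : ‖z‖ ≤ ‖(L.symm : E →L[ℝ] E)‖ * ‖L z‖ := by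
    simpa using (L.symm : E →L[ℝ] E).le_opNorm (L z)
  have h2 := norm_iteratedFDeriv_comp_clm_le (g.smooth ⊤) (L : E →L[ℝ] E) l z
  calc ‖z‖ ^ k * ‖iteratedFDeriv ℝ l (SchwartzMap.compCLMOfContinuousLinearEquiv ℂ L g : E → ℂ) z‖
      ≤ (‖(L.symm : E →L[ℝ] E)‖ * ‖L z‖) ^ k *
          (‖(L : E →L[ℝ] E)‖ ^ l * ‖iteratedFDeriv ℝ l g (L z)‖) := by
        gcongr
        exact h2
    _ = ‖(L.symm : E →L[ℝ] E)‖ ^ k * ‖(L : E →L[ℝ] E)‖ ^ l *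
          (‖L z‖ ^ k * ‖iteratedFDeriv ℝ l g (L z)‖) := by ring
    _ ≤ _ := by
        gcongr
        exact SchwartzMap.le_seminorm ℂ _ _ _ _

/-! ### Rapidly small families of Schwartz functions -/

/-- All Schwartz seminorms of the family `f` are `O(t ^ N)` on `s`, for every `N`. -/
def RapidlySmall {ι : Type*} (s : Set ι) (t : ι → ℝ) (f : ι → 𝓢(E, ℂ)) : Prop :=
  ∀ k l N : ℕ, ∃ C : ℝ, 0 ≤ C ∧ ∀ i ∈ s, SchwartzMap.seminorm ℂ k l (f i) ≤ C * t i ^ N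

/-- The functions `a i` are smooth, with derivatives bounded uniformly in `i ∈ s`. -/
def BoundedDerivs {ι : Type*} (s : Set ι) (a : ι → E → ℂ) : Prop :=
  (∀ i ∈ s, ContDiff ℝ ∞ (a i)) ∧
    ∀ l : ℕ, ∃ B : ℝ, 0 ≤ B ∧ ∀ i ∈ s, ∀ z, ‖iteratedFDeriv ℝ l (a i) z‖ ≤ B

variable {ι : Type*} {s : Set ι} {t : ι → ℝ}

theorem BoundedDerivs.exists_le {a : ι → E → ℂ} (ha : BoundedDerivs s a) (l : ℕ) :
    ∃ B : ℝ, 0 ≤ B ∧ ∀ i ∈ s, ∀ j ≤ l, ∀ z, ‖iteratedFDeriv ℝ j (a i) z‖ ≤ B := by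
  choose B hB0 hB using ha.2
  refine ⟨∑ j ∈ Finset.range (l + 1), B j, Finset.sum_nonneg fun j _ => hB0 j,
    fun i hi j hj z => (hB j i hi z).trans ?_⟩
  exact Finset.single_le_sum (f := B) (fun j _ => hB0 j) (Finset.mem_range.mpr (by omega))

theorem BoundedDerivs.sub {a b : ι → E → ℂ} (ha : BoundedDerivs s a) (hb : BoundedDerivs s b) :
    BoundedDerivs s (fun i z => a i z - b i z) := by
  refine ⟨fun i hi => (ha.1 i hi).sub (hb.1 i hi), fun l => ?_⟩
  obtain ⟨A, hA0, hA⟩ := ha.2 l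
  obtain ⟨B, hB0, hB⟩ := hb.2 l
  refine ⟨A + B, by positivity, fun i hi z => ?_⟩
  have h1 : iteratedFDeriv ℝ l (fun z => a i z - b i z) z =
      iteratedFDeriv ℝ l (a i) z - iteratedFDeriv ℝ l (b i) z :=
    iteratedFDeriv_sub_apply ((ha.1 i hi).contDiffAt.of_le (mod_cast le_top))
      ((hb.1 i hi).contDiffAt.of_le (mod_cast le_top))
  rw [h1]
  exact (norm_sub_le _ _).trans (add_le_add (hA i hi z) (hB i hi z))

theorem BoundedDerivs.mul {a b : ι → E → ℂ} (ha : BoundedDerivs s a) (hb : BoundedDerivs s b) :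
    BoundedDerivs s (fun i z => a i z * b i z) := by
  refine ⟨fun i hi => (ha.1 i hi).mul (hb.1 i hi), fun l => ?_⟩
  obtain ⟨A, hA0, hA⟩ := ha.exists_le l
  obtain ⟨B, hB0, hB⟩ := hb.exists_le l
  refine ⟨∑ j ∈ Finset.range (l + 1), (l.choose j : ℝ) * A * B, by positivity, fun i hi z => ?_⟩
  refine (norm_iteratedFDeriv_mul_le (N := ∞) (ha.1 i hi) (hb.1 i hi) z
    (mod_cast le_top)).trans (Finset.sum_le_sum fun j hj => ?_)
  have hj' : j ≤ l := Nat.lt_succ_iff.mp (Finset.mem_range.mp hj)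
  gcongr
  · exact hA i hi j hj' z
  · exact hB i hi _ (by omega) z

theorem BoundedDerivs.const (c : ℂ) : BoundedDerivs s (fun _ (_ : E) => c) := by
  refine ⟨fun i _ => contDiff_const, fun l => ⟨‖c‖, norm_nonneg _, fun i _ z => ?_⟩⟩
  rcases l with _ | l
  · simp
  · rw [iteratedFDeriv_const_of_ne (by omega)]
    simp

/-- A Schwartz function precomposed with affine maps of bounded linear part. -/
theorem BoundedDerivs.comp_affine (g : 𝓢(E, ℂ)) (L : ι → E →L[ℝ] E) (y : ι → E) {B : ℝ}
    (hL : ∀ i ∈ s, ‖L i‖ ≤ B) : BoundedDerivs s (fun i z => g (L i z + y i)) := by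
  refine ⟨fun i _ => (g.smooth ⊤).comp ((L i).contDiff.add contDiff_const), fun l => ?_⟩
  refine ⟨max B 0 ^ l * SchwartzMap.seminorm ℂ 0 l g, by positivity, fun i hi z => ?_⟩
  have h1 := norm_iteratedFDeriv_comp_clm_le (f := fun w => g (w + y i))
    ((g.smooth ⊤).comp (contDiff_id.add contDiff_const)) (L i) l z
  refine h1.trans ?_
  rw [iteratedFDeriv_comp_add_right]
  gcongr
  · exact (hL i hi).trans (le_max_left _ _)
  · exact SchwartzMap.norm_iteratedFDeriv_le_seminorm ℂ g l _

theorem BoundedDerivs.comp_sub (g : 𝓢(E, ℂ)) (y : ι → E) :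
    BoundedDerivs s (fun i z => g (z - y i)) := by
  simpa [sub_eq_add_neg] using BoundedDerivs.comp_affine (s := s) g
    (fun _ => ContinuousLinearMap.id ℝ E) (fun i => - y i) (B := ‖ContinuousLinearMap.id ℝ E‖)
    (fun _ _ => le_rfl)

theorem RapidlySmall.congr {f g : ι → 𝓢(E, ℂ)} (hf : RapidlySmall s t f)
    (hfg : ∀ i ∈ s, f i = g i) : RapidlySmall s t g := by
  intro k l N
  obtain ⟨C, hC0, hC⟩ := hf k l N
  exact ⟨C, hC0, fun i hi => hfg i hi ▸ hC i hi⟩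

/-- Every continuous seminorm is controlled by finitely many standard ones, so rapid smallness
survives continuous linear maps and can be tested against tempered distributions. -/
theorem RapidlySmall.exists_seminorm_le {f : ι → 𝓢(E, ℂ)} (hf : RapidlySmall s t f)
    (q : Seminorm ℂ 𝓢(E, ℂ)) (hq : Continuous q) (N : ℕ) :
    ∃ C : ℝ, 0 ≤ C ∧ ∀ i ∈ s, q (f i) ≤ C * t i ^ N := by
  obtain ⟨n, C, hC0, hC⟩ := exists_seminorm_le_sum q hq
  choose D hD0 hD using fun k l => hf k l N
  refine ⟨C * ∑ k ∈ Finset.range n, ∑ l ∈ Finset.range n, D k l, mul_nonneg hC0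
    (Finset.sum_nonneg fun k _ => Finset.sum_nonneg fun l _ => hD0 k l), fun i hi => ?_⟩
  refine (hC (f i)).trans ?_
  rw [mul_assoc, Finset.sum_mul]
  refine mul_le_mul_of_nonneg_left (Finset.sum_le_sum fun k _ => ?_) hC0
  rw [Finset.sum_mul]
  exact Finset.sum_le_sum fun l _ => hD k l i hi

theorem RapidlySmall.clm {f : ι → 𝓢(E, ℂ)} (hf : RapidlySmall s t f)
    (L : 𝓢(E, ℂ) →L[ℂ] 𝓢(E, ℂ)) : RapidlySmall s t (fun i => L (f i)) := by
  intro k l N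
  exact hf.exists_seminorm_le ((schwartzSeminormFamily ℂ E ℂ (k, l)).comp L.toLinearMap)
    (((schwartz_withSeminorms ℂ E ℂ).continuous_seminorm (k, l)).comp L.continuous) N

theorem RapidlySmall.distribution {f : ι → 𝓢(E, ℂ)} (hf : RapidlySmall s t f)
    (u : 𝓢'(E, ℂ)) (N : ℕ) : ∃ C : ℝ, 0 ≤ C ∧ ∀ i ∈ s, ‖u (f i)‖ ≤ C * t i ^ N :=
  hf.exists_seminorm_le ((normSeminorm ℂ ℂ).comp u.toLinearMap)
    (continuous_norm.comp u.continuous) N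

/-- A scalar that blows up like `t ^ (-m)` is harmless: use the bound of order `N + m`. -/
theorem RapidlySmall.smul {f : ι → 𝓢(E, ℂ)} (hf : RapidlySmall s t f) (ht : ∀ i ∈ s, 0 < t i)
    (c : ι → ℂ) (m : ℕ) {B : ℝ} (hc : ∀ i ∈ s, ‖c i‖ * t i ^ m ≤ B) :
    RapidlySmall s t (fun i => c i • f i) := by
  intro k l N
  obtain ⟨C, hC0, hC⟩ := hf k l (N + m)
  refine ⟨max B 0 * C, by positivity, fun i hi => ?_⟩
  rw [map_smul_eq_mul]
  have := ht i hi
  calc ‖c i‖ * SchwartzMap.seminorm ℂ k l (f i) ≤ ‖c i‖ * (C * t i ^ (N + m)) := by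
        gcongr
        exact hC i hi
    _ = (‖c i‖ * t i ^ m) * (C * t i ^ N) := by ring
    _ ≤ max B 0 * (C * t i ^ N) := by
        gcongr
        exact (hc i hi).trans (le_max_left _ _)
    _ = _ := by ring

theorem RapidlySmall.mul {f F : ι → 𝓢(E, ℂ)} {a : ι → E → ℂ} (hf : RapidlySmall s t f)
    (ha : BoundedDerivs s a) (hF : ∀ i ∈ s, ∀ z, F i z = a i z * f i z) :
    RapidlySmall s t F := by
  intro k l N
  obtain ⟨B, hB0, hB⟩ := ha.exists_le l
  choose C hC0 hC using fun j => hf k j N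
  refine ⟨2 ^ l * B * 1 * ∑ j ∈ Finset.range (l + 1), C j,
    mul_nonneg (by positivity) (Finset.sum_nonneg fun j _ => hC0 j), fun i hi => ?_⟩
  refine (seminorm_mul_le (N := 0) (ha.1 i hi) (hF i hi) hB0 zero_le_one (hB i hi)
    (fun z => Or.inr (by simp))).trans ?_
  rw [mul_assoc (2 ^ l * B * 1), Finset.sum_mul]
  gcongr with j hj
  exact hC j i hi

theorem RapidlySmall.translate {f : ι → 𝓢(E, ℂ)} (hf : RapidlySmall s t f)
    (ht : ∀ i ∈ s, 0 < t i) (y : ι → E) (m : ℕ) {B : ℝ}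
    (hy : ∀ i ∈ s, (1 + ‖y i‖) * t i ^ m ≤ B) :
    RapidlySmall s t (fun i => SchwartzMap.compSubConstCLM ℂ (y i) (f i)) := by
  intro k l N
  -- Translation costs `(1 + ‖y‖) ^ k`, and each factor `1 + ‖y‖` costs `t ^ (-m)`.
  obtain ⟨C, hC0, hC⟩ := hf 0 l (N + m * k)
  obtain ⟨D, hD0, hD⟩ := hf k l (N + m * k)
  refine ⟨(max B 0) ^ k * (2 ^ k * (C + D)), by positivity,
    fun i hi => ?_⟩
  have hti := ht i hi
  refine (seminorm_compSubConst_le (f i) (y i) k l).trans ?_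
  calc (1 + ‖y i‖) ^ k * (2 ^ k * (SchwartzMap.seminorm ℂ 0 l (f i) +
        SchwartzMap.seminorm ℂ k l (f i)))
      ≤ (1 + ‖y i‖) ^ k * (2 ^ k * (C * t i ^ (N + m * k) + D * t i ^ (N + m * k))) := by
        gcongr
        · exact hC i hi
        · exact hD i hi
    _ = ((1 + ‖y i‖) * t i ^ m) ^ k * (2 ^ k * (C + D)) * t i ^ N := by
        rw [pow_add, pow_mul, mul_pow]; ring
    _ ≤ (max B 0) ^ k * (2 ^ k * (C + D)) * t i ^ N := by
        gcongr
        exact (hy i hi).trans (le_max_left _ _)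

/-- Cutting off a fixed Schwartz function away from balls of radius `δ / t i`. -/
theorem RapidlySmall.of_vanish {g : 𝓢(E, ℂ)} {F : ι → 𝓢(E, ℂ)} {a : ι → E → ℂ} {δ : ℝ}
    (hδ : 0 < δ) (ht : ∀ i ∈ s, 0 < t i) (ha : BoundedDerivs s a)
    (hF : ∀ i ∈ s, ∀ z, F i z = a i z * g z)
    (hv : ∀ i ∈ s, ∀ z, t i * ‖z‖ < δ → a i z = 0) : RapidlySmall s t F := by
  intro k l N
  obtain ⟨B, hB0, hB⟩ := ha.exists_le l
  refine ⟨2 ^ l * B * (δ⁻¹ ^ N) * ∑ j ∈ Finset.range (l + 1), SchwartzMap.seminorm ℂ (k + N) j g,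
    mul_nonneg (by positivity) (Finset.sum_nonneg fun j _ => apply_nonneg _ _), fun i hi => ?_⟩
  have hti := ht i hi
  -- Where the cutoff is nonzero, `t ‖z‖ ≥ δ`, that is `1 ≤ (t / δ) ^ N ‖z‖ ^ N`: decay of `g` is
  -- traded for powers of `t`.
  refine (seminorm_mul_le (N := N) (c := (t i * δ⁻¹) ^ N) (ha.1 i hi) (hF i hi) hB0
    (by positivity) (hB i hi) (fun z => ?_)).trans (le_of_eq ?_)
  · rcases lt_or_ge (t i * ‖z‖) δ with hz | hz
    · left
      have hopen : IsOpen {z : E | t i * ‖z‖ < δ} := isOpen_lt (by fun_prop) (by fun_prop)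
      filter_upwards [hopen.mem_nhds hz] with y hy using hv i hi y hy
    · right
      rw [← mul_pow]
      refine one_le_pow₀ ?_
      rw [mul_assoc, mul_comm δ⁻¹, ← mul_assoc, ← div_eq_mul_inv, le_div_iff₀ hδ, one_mul]
      exact hz
  · rw [mul_pow]; ring

/-- Dilates of a fixed Schwartz function, cut off away from a fixed ball. -/
theorem RapidlySmall.of_dilate {g : 𝓢(E, ℂ)} {F : ι → 𝓢(E, ℂ)} {a : ι → E → ℂ}
    {L : ι → E ≃L[ℝ] E} {δ A T : ℝ} {m : ℕ} (hδ : 0 < δ) (ht : ∀ i ∈ s, 0 < t i)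
    (hT : ∀ i ∈ s, t i ≤ T) (ha : BoundedDerivs s a)
    (hF : ∀ i ∈ s, ∀ z, F i z = a i z * g (L i z))
    (hv : ∀ i ∈ s, ∀ z, ‖z‖ < δ → a i z = 0)
    (hL : ∀ i ∈ s, ‖((L i).symm : E →L[ℝ] E)‖ ≤ t i)
    (hL' : ∀ i ∈ s, ‖(L i : E →L[ℝ] E)‖ * t i ^ m ≤ A) : RapidlySmall s t F := by
  intro k l N
  obtain ⟨B, hB0, hB⟩ := ha.exists_le l
  -- The inverse dilation gains `t ^ (k + M)`, while up to `l` derivatives each cost `‖L‖ ≤ A t ^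
  -- (-m)`; the surplus `m * l` pays for them.
  set M := N + m * l with hM
  have key : ∀ i ∈ s, ∀ j ∈ Finset.range (l + 1),
      SchwartzMap.seminorm ℂ (k + M) j (SchwartzMap.compCLMOfContinuousLinearEquiv ℂ (L i) g) ≤
        (max T 1 ^ (k + m * l) * max A 1 ^ l * SchwartzMap.seminorm ℂ (k + M) j g) * t i ^ N := by
    intro i hi j hj
    have hti := ht i hi
    have hj' : j ≤ l := Nat.lt_succ_iff.mp (Finset.mem_range.mp hj)
    have e1 : t i ^ (k + M) * ‖(L i : E →L[ℝ] E)‖ ^ j =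
        t i ^ (k + m * (l - j)) * (‖(L i : E →L[ℝ] E)‖ * t i ^ m) ^ j * t i ^ N := by
      have : k + M = k + m * (l - j) + m * j + N := by
        rw [hM]
        have : m * l = m * (l - j) + m * j := by rw [← mul_add, Nat.sub_add_cancel hj']
        omega
      rw [this, pow_add, pow_add (t i) (k + m * (l - j)), mul_pow, pow_mul (t i) m j]
      ring
    have e2 : t i ^ (k + m * (l - j)) ≤ max T 1 ^ (k + m * l) :=
      (pow_le_pow_left₀ hti.le ((hT i hi).trans (le_max_left _ _)) _).trans
        (pow_le_pow_right₀ (le_max_right _ _) (by gcongr; omega))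
    have e3 : (‖(L i : E →L[ℝ] E)‖ * t i ^ m) ^ j ≤ max A 1 ^ l :=
      (pow_le_pow_left₀ (by positivity) ((hL' i hi).trans (le_max_left _ _)) _).trans
        (pow_le_pow_right₀ (le_max_right _ _) hj')
    refine (seminorm_compEquiv_le g (L i) (k + M) j).trans ?_
    calc ‖((L i).symm : E →L[ℝ] E)‖ ^ (k + M) * ‖(L i : E →L[ℝ] E)‖ ^ j *
          SchwartzMap.seminorm ℂ (k + M) j g
        ≤ t i ^ (k + M) * ‖(L i : E →L[ℝ] E)‖ ^ j * SchwartzMap.seminorm ℂ (k + M) j g := by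
          gcongr
          exact hL i hi
      _ ≤ max T 1 ^ (k + m * l) * max A 1 ^ l * t i ^ N *
          SchwartzMap.seminorm ℂ (k + M) j g := by
          rw [e1]
          gcongr
      _ = _ := by ring
  refine ⟨2 ^ l * B * (δ⁻¹ ^ M) * ∑ j ∈ Finset.range (l + 1),
    max T 1 ^ (k + m * l) * max A 1 ^ l * SchwartzMap.seminorm ℂ (k + M) j g,
    mul_nonneg (by positivity) (Finset.sum_nonneg fun j _ => by positivity), fun i hi => ?_⟩
  refine (seminorm_mul_le (N := M) (c := δ⁻¹ ^ M) (ha.1 i hi) (hF i hi) hB0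
    (by positivity) (hB i hi) (fun z => ?_)
    (g := SchwartzMap.compCLMOfContinuousLinearEquiv ℂ (L i) g)).trans ?_
  · rcases lt_or_ge ‖z‖ δ with hz | hz
    · left
      have hopen : IsOpen {z : E | ‖z‖ < δ} := isOpen_lt (by fun_prop) (by fun_prop)
      filter_upwards [hopen.mem_nhds hz] with y hy using hv i hi y hy
    · right
      rw [← mul_pow]
      refine one_le_pow₀ ?_
      rwa [mul_comm, ← div_eq_mul_inv, le_div_iff₀ hδ, one_mul]
  · rw [mul_assoc (2 ^ l * B * δ⁻¹ ^ M), Finset.sum_mul]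
    gcongr with j hj
    exact key i hi j hj

end Schwartz

section Weight

/-! ### Weights and cutoff functions -/

variable {E : Type*} [NormedAddCommGroup E]

/-- The polynomial weight `(1 + ‖y‖²) ^ n`. -/
def weight (n : ℕ) (y : E) : ℂ := (((1 + ‖y‖ ^ 2) ^ n : ℝ) : ℂ)

/-- Squaring the norm keeps the weight smooth at `0`, so that multiplication by it preserves
Schwartz space. -/
theorem hasTemperateGrowth_weight [InnerProductSpace ℝ E] (n : ℕ) : (weight n : E → ℂ).HasTemperateGrowth := by
  unfold weight
  fun_prop

theorem norm_weight (n : ℕ) (y : E) : ‖weight n y‖ = (1 + ‖y‖ ^ 2) ^ n := by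
  rw [weight, Complex.norm_real, Real.norm_of_nonneg (by positivity)]

theorem one_add_norm_pow_le (n : ℕ) (y : E) : (1 + ‖y‖) ^ n ≤ 2 ^ n * (1 + ‖y‖ ^ 2) ^ n := by
  rw [← mul_pow]
  gcongr
  nlinarith [sq_nonneg (‖y‖ - 1), norm_nonneg y]

/-- This rests on `1 + ‖z‖ ≤ (1 + ‖y‖)(1 + ‖z - y‖)`. It provides the domination when a density of
polynomial growth is integrated against translates of `χ`. -/
theorem norm_comp_sub_le [NormedSpace ℝ E] (χ : 𝓢(E, ℂ)) (N : ℕ) :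
    ∃ C : ℝ, 0 ≤ C ∧ ∀ y z : E, ‖χ (z - y)‖ ≤ C * (1 + ‖y‖) ^ N * ((1 + ‖z‖) ^ N)⁻¹ := by
  have h := fun w => SchwartzMap.one_add_le_sup_seminorm_apply (𝕜 := ℂ) (m := (N, 0)) (k := N)
    (n := 0) le_rfl le_rfl χ w
  simp only [norm_iteratedFDeriv_zero] at h
  obtain ⟨C, hC⟩ : ∃ C : ℝ, ∀ w : E, (1 + ‖w‖) ^ N * ‖χ w‖ ≤ C := ⟨_, h⟩
  have hC0 : 0 ≤ C := le_trans (by positivity) (hC 0)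
  refine ⟨C, hC0, fun y z => ?_⟩
  rw [← div_eq_mul_inv, le_div_iff₀ (by positivity)]
  have h1 : (1 + ‖z‖) ≤ (1 + ‖y‖) * (1 + ‖z - y‖) := by
    have := norm_add_le (z - y) y
    rw [sub_add_cancel] at this
    nlinarith [norm_nonneg y, norm_nonneg (z - y)]
  calc ‖χ (z - y)‖ * (1 + ‖z‖) ^ N ≤ ‖χ (z - y)‖ * ((1 + ‖y‖) * (1 + ‖z - y‖)) ^ N := by gcongr
    _ = ((1 + ‖z - y‖) ^ N * ‖χ (z - y)‖) * (1 + ‖y‖) ^ N := by rw [mul_pow]; ring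
    _ ≤ C * (1 + ‖y‖) ^ N := by gcongr; exact hC _

theorem exists_schwartz_bump [InnerProductSpace ℝ E] [FiniteDimensional ℝ E] (x : E) {r R : ℝ} (hr : 0 < r) (hR : r < R) :
    ∃ χ : 𝓢(E, ℂ), HasCompactSupport χ ∧ (∀ z ∈ Metric.closedBall x r, χ z = 1) ∧
      ∀ z ∉ Metric.ball x R, χ z = 0 := by
  let b : ContDiffBump x := ⟨r, R, hr, hR⟩
  have hb : HasCompactSupport (fun z => ((b z : ℝ) : ℂ)) :=
    b.hasCompactSupport.comp_left (g := ((↑) : ℝ → ℂ)) Complex.ofReal_zero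
  have hb1 : ContDiff ℝ ∞ (b : E → ℝ) := b.contDiff
  have hb2 : ContDiff ℝ ∞ (fun z => ((b z : ℝ) : ℂ)) := Complex.ofRealCLM.contDiff.comp hb1
  have hval : ∀ z, hb.toSchwartzMap hb2 z = b z := fun z => rfl
  refine ⟨hb.toSchwartzMap hb2, hb, fun z hz => ?_, fun z hz => ?_⟩
  · rw [hval, b.one_of_mem_closedBall hz, Complex.ofReal_one]
  · rw [hval, b.zero_of_le_dist (by simpa using hz), Complex.ofReal_zero]

theorem exists_cutoff [InnerProductSpace ℝ E] [FiniteDimensional ℝ E] (f : 𝓢(E, ℂ)) (hf : HasCompactSupport f) :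
    ∃ χ : 𝓢(E, ℂ), ∀ z, f z * χ z = f z := by
  obtain ⟨r, hr, hsub⟩ := hf.isBounded.subset_ball_lt 0 0
  obtain ⟨χ, -, hχ, -⟩ := exists_schwartz_bump (0 : E) hr (lt_add_one r)
  refine ⟨χ, fun z => ?_⟩
  by_cases hz : z ∈ tsupport f
  · rw [hχ z (Metric.ball_subset_closedBall (hsub hz)), mul_one]
  · rw [image_eq_zero_of_notMem_tsupport hz, zero_mul]

end Weight

section Pairing

variable {E : Type*} [NormedAddCommGroup E] [InnerProductSpace ℝ E] [FiniteDimensional ℝ E]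
  [MeasurableSpace E] [BorelSpace E]

/-! ### Pairing a tempered distribution with modulations of a Schwartz function -/

/-- The modulation `ξ ↦ exp (-2πi ⟪y, ξ⟫) f ξ`. -/
def modulate (y : E) (f : 𝓢(E, ℂ)) : 𝓢(E, ℂ) :=
  𝓕 (SchwartzMap.compSubConstCLM ℂ y (𝓕⁻ f))

theorem fourier_compSubConst_apply (y : E) (f : 𝓢(E, ℂ)) (ξ : E) :
    𝓕 (SchwartzMap.compSubConstCLM ℂ y f) ξ =
      (Real.fourierChar (-(inner ℝ y ξ)) : ℂ) * 𝓕 f ξ := by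
  have h := congrFun (VectorFourier.fourierIntegral_comp_add_right Real.fourierChar
    (volume : Measure E) (innerₗ E) f (-y)) ξ
  simp only [map_neg, LinearMap.neg_apply, innerₗ_apply_apply] at h
  rw [Circle.smul_def, smul_eq_mul] at h
  rw [SchwartzMap.fourier_coe, SchwartzMap.fourier_coe]
  have e : (SchwartzMap.compSubConstCLM ℂ y f : E → ℂ) = f ∘ fun v => v + -y := by
    ext z
    simp [sub_eq_add_neg]
  rw [e]
  exact h

theorem modulate_apply (y : E) (f : 𝓢(E, ℂ)) (ξ : E) :
    modulate y f ξ = (Real.fourierChar (-(inner ℝ y ξ)) : ℂ) * f ξ := by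
  rw [modulate, fourier_compSubConst_apply, FourierTransform.fourier_fourierInv_eq]

/-- Differentiating the Fourier integral brings down powers of `y`, so only moments of `g` enter. -/
theorem norm_iteratedFDeriv_fourier_le (g : 𝓢(E, ℂ)) (n : ℕ) (ξ : E) :
    ‖iteratedFDeriv ℝ n (𝓕 g : 𝓢(E, ℂ)) ξ‖ ≤
      (2 * Real.pi) ^ n * ∫ y, ‖y‖ ^ n * ‖g y‖ := by
  rw [SchwartzMap.fourier_coe, Real.iteratedFDeriv_fourier (N := ⊤)
    (fun n _ => g.integrable_pow_mul volume n) g.continuous.aestronglyMeasurable le_top,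
    Real.fourier_eq]
  refine (norm_integral_le_integral_norm _).trans ?_
  rw [← integral_const_mul]
  refine integral_mono_of_nonneg (.of_forall fun _ => norm_nonneg _)
    ((g.integrable_pow_mul volume n).const_mul _) (.of_forall fun y => ?_)
  simp only [Circle.norm_smul]
  refine (VectorFourier.norm_fourierPowSMulRight_le _ _ _ _).trans ?_
  rw [mul_assoc]
  have h1 : 2 * Real.pi * ‖innerSL ℝ (E := E)‖ ≤ 2 * Real.pi :=
    mul_le_of_le_one_right (by positivity) (norm_innerSL_le ℝ)
  exact mul_le_mul_of_nonneg_right (pow_le_pow_left₀ (by positivity) h1 n) (by positivity)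

theorem integrable_one_add_pow_mul_norm (g : 𝓢(E, ℂ)) (n : ℕ) :
    Integrable (fun y => (1 + ‖y‖) ^ n * ‖g y‖) := by
  simp only [add_pow, one_pow, one_mul, Finset.sum_mul]
  refine integrable_finsetSum _ fun i _ => ?_
  refine ((g.integrable_pow_mul volume (n - i)).mul_const (n.choose i : ℝ)).congr
    (.of_forall fun y => ?_)
  simp only
  ring

/-- The functional `g ↦ v (f · 𝓕 g)` is bounded by a weighted `L¹` norm. -/
theorem exists_norm_smul_fourier_le (v : 𝓢'(E, ℂ)) (f : 𝓢(E, ℂ)) :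
    ∃ (n : ℕ) (C : ℝ), 0 ≤ C ∧ ∀ g : 𝓢(E, ℂ),
      ‖v (SchwartzMap.smulLeftCLM ℂ f (𝓕 g))‖ ≤ C * ∫ y, (1 + ‖y‖) ^ n * ‖g y‖ := by
  obtain ⟨n, C, hC0, hC⟩ := exists_seminorm_le_sum ((normSeminorm ℂ ℂ).comp v.toLinearMap)
    (continuous_norm.comp v.continuous)
  have hf := f.hasTemperateGrowth
  have key : ∀ k l, l < n → ∀ g : 𝓢(E, ℂ),
      SchwartzMap.seminorm ℂ k l (SchwartzMap.smulLeftCLM ℂ f (𝓕 g)) ≤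
        2 ^ l * (2 * Real.pi) ^ n * 1 *
          (∑ i ∈ Finset.range (l + 1), SchwartzMap.seminorm ℂ (k + 0) i f) *
          ∫ y, (1 + ‖y‖) ^ n * ‖g y‖ := by
    intro k l hl g
    have hI : 0 ≤ ∫ y, (1 + ‖y‖) ^ n * ‖g y‖ := integral_nonneg fun y => by positivity
    -- Here `𝓕 g` plays the multiplier with bounded derivatives, and the fixed `f` supplies the
    -- decay.
    refine (seminorm_mul_le (N := 0) (a := (𝓕 g : 𝓢(E, ℂ))) (g := f) (c := 1)
      (B := (2 * Real.pi) ^ n * ∫ y, (1 + ‖y‖) ^ n * ‖g y‖) ((𝓕 g).smooth ⊤) (fun z => ?_)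
      (by positivity) zero_le_one (fun i hi z => ?_) (fun z => Or.inr (by simp))).trans
      (le_of_eq (by ring))
    · rw [SchwartzMap.smulLeftCLM_apply_apply hf, smul_eq_mul, mul_comm]
    · refine (norm_iteratedFDeriv_fourier_le g i z).trans ?_
      refine mul_le_mul (pow_le_pow_right₀ (by linarith [Real.pi_gt_three]) (by omega)) ?_
        (integral_nonneg fun y => by positivity) (by positivity)
      refine integral_mono (g.integrable_pow_mul volume i) (integrable_one_add_pow_mul_norm g n)
        fun y => ?_
      simp only
      gcongr
      refine (pow_le_pow_left₀ (norm_nonneg y) (by linarith) i).trans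
        (pow_le_pow_right₀ (by linarith [norm_nonneg y]) (by omega))
  refine ⟨n, C * ∑ k ∈ Finset.range n, ∑ l ∈ Finset.range n, 2 ^ l * (2 * Real.pi) ^ n * 1 *
          (∑ i ∈ Finset.range (l + 1), SchwartzMap.seminorm ℂ (k + 0) i f),
    mul_nonneg hC0 (Finset.sum_nonneg fun k _ => Finset.sum_nonneg fun l _ => mul_nonneg
      (by positivity) (Finset.sum_nonneg fun i _ => apply_nonneg _ _)), fun g => ?_⟩
  refine (hC _).trans ?_
  rw [mul_assoc]
  gcongr
  rw [Finset.sum_mul]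
  gcongr with k hk
  rw [Finset.sum_mul]
  gcongr with l hl
  exact key k l (Finset.mem_range.mp hl) g

theorem integrable_weight_inv : ∃ m : ℕ, Integrable (fun y : E => ((1 + ‖y‖ ^ 2) ^ m)⁻¹) := by
  obtain ⟨m, hm⟩ := Measure.HasTemperateGrowth.exists_integrable (μ := (volume : Measure E))
  refine ⟨m, (hm.const_mul (2 ^ m)).mono' (by fun_prop) (.of_forall fun y => ?_)⟩
  rw [Real.norm_of_nonneg (by positivity), Real.rpow_neg (by positivity), Real.rpow_natCast,
    ← div_eq_mul_inv, inv_le_comm₀ (by positivity) (by positivity), inv_div,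
    div_le_iff₀ (by positivity), mul_comm]
  exact one_add_norm_pow_le m y

/-- A functional bounded by a weighted `L¹` norm is integration against a function. -/
theorem exists_density (T : 𝓢(E, ℂ) →ₗ[ℂ] ℂ) (n : ℕ) (C : ℝ)
    (hT : ∀ g : 𝓢(E, ℂ), ‖T g‖ ≤ C * ∫ y, (1 + ‖y‖) ^ n * ‖g y‖) :
    ∃ (D : E → ℂ) (N : ℕ), Integrable (fun y => (((1 + ‖y‖) ^ N)⁻¹ : ℝ) • D y) ∧
      ∀ g : 𝓢(E, ℂ), T g = ∫ y, D y * g y := by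
  obtain ⟨m, hm⟩ := integrable_weight_inv (E := E)
  have hb1 : ∀ y : E, ((1 + ‖y‖ ^ 2) ^ m)⁻¹ ≤ 1 := fun y =>
    inv_le_one_of_one_le₀ (one_le_pow₀ (by nlinarith [sq_nonneg ‖y‖]))
  have hb2 : MemLp (fun y : E => ((1 + ‖y‖ ^ 2) ^ m)⁻¹) 2 := by
    rw [memLp_two_iff_integrable_sq (by fun_prop)]
    refine hm.mono' (by fun_prop) (.of_forall fun y => ?_)
    have h0 : 0 ≤ ((1 + ‖y‖ ^ 2) ^ m)⁻¹ := by positivity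
    rw [Real.norm_of_nonneg (by positivity)]
    nlinarith [hb1 y]
  set N := n + m with hN
  -- By Cauchy–Schwarz the weighted `L¹` norm is at most a multiple of the `L²` norm of `(1 + ‖y‖²)
  -- ^ N g`, the spare factor `(1 + ‖y‖²) ^ (-m)` lying in `L²`. So `T` factors through a bounded
  -- functional on `L²`, represented by some `w`, and the density is `conj w` times the weight.
  let A : 𝓢(E, ℂ) →L[ℂ] Lp ℂ 2 (volume : Measure E) :=
    (SchwartzMap.toLpCLM ℂ ℂ 2 volume).comp (SchwartzMap.smulLeftCLM ℂ (weight N))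
  have hw := hasTemperateGrowth_weight (E := E) N
  have hAdense : DenseRange A := by
    refine (SchwartzMap.denseRange_toLpCLM (by simp)).comp
      (Function.Surjective.denseRange fun g => ?_) (SchwartzMap.toLpCLM ℂ ℂ 2 volume).continuous
    have hi : (fun x : E => (((1 + ‖x‖ ^ 2) ^ (-(N : ℝ)) : ℝ) : ℂ)).HasTemperateGrowth := by
      fun_prop
    refine ⟨SchwartzMap.smulLeftCLM ℂ
      (fun x : E => (((1 + ‖x‖ ^ 2) ^ (-(N : ℝ)) : ℝ) : ℂ)) g, ?_⟩
    ext y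
    change SchwartzMap.smulLeftCLM ℂ (weight N) (SchwartzMap.smulLeftCLM ℂ _ g) y = g y
    rw [SchwartzMap.smulLeftCLM_apply_apply hw, SchwartzMap.smulLeftCLM_apply_apply hi, weight,
      smul_eq_mul, smul_eq_mul, ← mul_assoc, ← Complex.ofReal_mul, Real.rpow_neg (by positivity),
      Real.rpow_natCast, mul_inv_cancel₀ (by positivity), Complex.ofReal_one, one_mul]
  have hAnorm : ∃ C', ∀ g, ‖T g‖ ≤ C' * ‖A.toLinearMap g‖ := by
    refine ⟨|C| * (2 ^ n * (∫ y : E, ‖((1 + ‖y‖ ^ 2) ^ m)⁻¹‖ ^ (2 : ℝ)) ^ (1 / (2 : ℝ))), fun g => ?_⟩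
    set q := SchwartzMap.smulLeftCLM ℂ (weight N) g with hq
    have hqy : ∀ y, ‖q y‖ = (1 + ‖y‖ ^ 2) ^ N * ‖g y‖ := fun y => by
      rw [hq, SchwartzMap.smulLeftCLM_apply_apply hw, norm_smul, norm_weight]
    have hAg : ‖A.toLinearMap g‖ = (∫ y, ‖q y‖ ^ (2 : ℝ)) ^ (1 / (2 : ℝ)) := by
      change ‖q.toLp 2 volume‖ = _
      rw [SchwartzMap.norm_toLp' (by simp) (by simp)]
      simp
    have h1 := integral_mul_le_Lp_mul_Lq_of_nonneg (μ := (volume : Measure E))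
      Real.HolderConjugate.two_two (f := fun y => ‖((1 + ‖y‖ ^ 2) ^ m)⁻¹‖) (g := fun y => ‖q y‖)
      (.of_forall fun y => norm_nonneg _) (.of_forall fun y => norm_nonneg _)
      (by simpa using hb2.norm) (by simpa using (q.memLp 2 volume).norm)
    have h2 : ∫ y, (1 + ‖y‖) ^ n * ‖g y‖ ≤ 2 ^ n * ∫ y, ‖((1 + ‖y‖ ^ 2) ^ m)⁻¹‖ * ‖q y‖ := by
      rw [← integral_const_mul]
      refine integral_mono (integrable_one_add_pow_mul_norm g n) ?_ fun y => ?_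
      · refine Integrable.const_mul ?_ _
        refine q.integrable.norm.mono' (by fun_prop) (.of_forall fun y => ?_)
        rw [norm_mul, norm_norm, norm_norm, Real.norm_of_nonneg (by positivity)]
        exact mul_le_of_le_one_left (norm_nonneg _) (hb1 y)
      · simp only
        rw [hqy, Real.norm_of_nonneg (by positivity), hN, pow_add]
        have : 0 < (1 + ‖y‖ ^ 2) ^ m := by positivity
        calc (1 + ‖y‖) ^ n * ‖g y‖ ≤ 2 ^ n * (1 + ‖y‖ ^ 2) ^ n * ‖g y‖ := by
              gcongr
              exact one_add_norm_pow_le n y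
          _ = _ := by field_simp
    calc ‖T g‖ ≤ C * ∫ y, (1 + ‖y‖) ^ n * ‖g y‖ := hT g
      _ ≤ |C| * ∫ y, (1 + ‖y‖) ^ n * ‖g y‖ := by
          gcongr
          exact le_abs_self C
      _ ≤ |C| * (2 ^ n * ∫ y, ‖((1 + ‖y‖ ^ 2) ^ m)⁻¹‖ * ‖q y‖) := by gcongr
      _ ≤ _ := by
          rw [hAg, mul_assoc, mul_assoc]
          gcongr
  let Λ := T.extendOfNorm A.toLinearMap
  let w := (InnerProductSpace.toDual ℂ (Lp ℂ 2 (volume : Measure E))).symm Λ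
  have hrep : ∀ g, T g = ∫ y, (starRingEnd ℂ (w y) * weight N y) * g y := by
    intro g
    rw [← LinearMap.extendOfNorm_eq hAdense hAnorm g]
    change Λ (A g) = _
    rw [← InnerProductSpace.toDual_symm_apply (𝕜 := ℂ) (x := A g) (y := Λ), L2.inner_def]
    refine integral_congr_ae ?_
    filter_upwards [(SchwartzMap.smulLeftCLM ℂ (weight N) g).coeFn_toLp 2 volume] with y hy
    change inner ℂ (w y) (((SchwartzMap.smulLeftCLM ℂ (weight N) g).toLp 2 volume :
      Lp ℂ 2 (volume : Measure E)) y) = _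
    rw [hy, SchwartzMap.smulLeftCLM_apply_apply hw, RCLike.inner_apply, smul_eq_mul]
    ring
  refine ⟨fun y => starRingEnd ℂ (w y) * weight N y, 2 * (N + m), ?_, hrep⟩
  have hwL : MemLp (fun y => ‖w y‖) 2 (volume : Measure E) := (Lp.memLp w).norm
  have hint : Integrable (fun y => ((1 + ‖y‖ ^ 2) ^ m)⁻¹ * ‖w y‖) := hb2.integrable_mul hwL
  refine hint.mono' ?_ (.of_forall fun y => ?_)
  · have h1 : AEStronglyMeasurable (fun y => starRingEnd ℂ (w y)) (volume : Measure E) :=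
      Complex.continuous_conj.comp_aestronglyMeasurable (Lp.aestronglyMeasurable w)
    have h2 : Continuous (weight N : E → ℂ) := by unfold weight; fun_prop
    have h3 : Continuous (fun y : E => (((1 + ‖y‖) ^ (2 * (N + m)))⁻¹ : ℝ)) :=
      Continuous.inv₀ (by fun_prop) fun y => by positivity
    exact h3.aestronglyMeasurable.smul (h1.mul h2.aestronglyMeasurable)
  · have hle : ((1 + ‖y‖) ^ (2 * (N + m)))⁻¹ ≤ ((1 + ‖y‖ ^ 2) ^ (N + m))⁻¹ := by
      rw [pow_mul]
      gcongr
      nlinarith [norm_nonneg y]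
    rw [norm_smul, norm_mul, norm_weight, Real.norm_of_nonneg (by positivity), RCLike.norm_conj]
    calc ((1 + ‖y‖) ^ (2 * (N + m)))⁻¹ * (‖w y‖ * (1 + ‖y‖ ^ 2) ^ N)
        ≤ ((1 + ‖y‖ ^ 2) ^ (N + m))⁻¹ * (‖w y‖ * (1 + ‖y‖ ^ 2) ^ N) := by gcongr
      _ = _ := by
          rw [pow_add]
          have : 0 < (1 + ‖y‖ ^ 2) ^ m := by positivity
          field_simp

/-- For compactly supported `f`, the distribution `𝓕 (f v)` is the continuous function
`y ↦ v (modulate y f)`. -/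
theorem continuous_modulate_and_fourier_pairing (v : 𝓢'(E, ℂ)) (f : 𝓢(E, ℂ))
    (hf : HasCompactSupport f) :
    Continuous (fun y => v (modulate y f)) ∧ ∀ g P : 𝓢(E, ℂ), (∀ z, P z = f z * 𝓕 g z) →
      Integrable (fun y => v (modulate y f) * g y) ∧ v P = ∫ y, v (modulate y f) * g y := by
  obtain ⟨χ', hχ'⟩ := exists_cutoff f hf
  set χ : 𝓢(E, ℂ) := 𝓕⁻ χ' with hχ
  have hχF : 𝓕 χ = χ' := FourierTransform.fourier_fourierInv_eq χ'
  have hft := f.hasTemperateGrowth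
  obtain ⟨n, C, hC0, hC⟩ := exists_norm_smul_fourier_le v f
  let T : 𝓢(E, ℂ) →ₗ[ℂ] ℂ :=
    v.toLinearMap ∘ₗ (SchwartzMap.smulLeftCLM ℂ f).toLinearMap ∘ₗ
      (FourierTransform.fourierCLM ℂ 𝓢(E, ℂ)).toLinearMap
  have hTapply : ∀ g, T g = v (SchwartzMap.smulLeftCLM ℂ f (𝓕 g)) := fun g => rfl
  obtain ⟨D, N, hD, hrep⟩ := exists_density T n C hC
  obtain ⟨B, hB0, hB⟩ := norm_comp_sub_le χ N
  have hDm : AEStronglyMeasurable D (volume : Measure E) := by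
    have h3 : Continuous (fun y : E => ((1 + ‖y‖) ^ N : ℝ)) := by fun_prop
    refine (h3.aestronglyMeasurable.smul hD.aestronglyMeasurable).congr (.of_forall fun y => ?_)
    change ((1 + ‖y‖) ^ N : ℝ) • (((1 + ‖y‖) ^ N)⁻¹ : ℝ) • D y = D y
    rw [smul_smul, mul_inv_cancel₀ (by positivity), one_smul]
  have hmod : ∀ y, v (modulate y f) = ∫ z, D z * χ (z - y) := by
    intro y
    have h1 := hrep (SchwartzMap.compSubConstCLM ℂ y χ)
    rw [hTapply] at h1
    simp only [SchwartzMap.compSubConstCLM_apply] at h1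
    rw [← h1]
    congr 1
    ext ξ
    rw [modulate_apply, SchwartzMap.smulLeftCLM_apply_apply hft, fourier_compSubConst_apply, hχF,
      smul_eq_mul, mul_left_comm, hχ']
  have hbound : ∀ y z, ‖D z * χ (z - y)‖ ≤
      B * (1 + ‖y‖) ^ N * ‖(((1 + ‖z‖) ^ N)⁻¹ : ℝ) • D z‖ := by
    intro y z
    rw [norm_mul, norm_smul, Real.norm_of_nonneg (by positivity)]
    calc ‖D z‖ * ‖χ (z - y)‖ ≤ ‖D z‖ * (B * (1 + ‖y‖) ^ N * ((1 + ‖z‖) ^ N)⁻¹) := by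
          gcongr
          exact hB y z
      _ = _ := by ring
  refine ⟨?_, fun g P hP => ?_⟩
  · simp only [hmod]
    rw [continuous_iff_continuousAt]
    intro y₀
    refine continuousAt_of_dominated
      (bound := fun z => B * (1 + (‖y₀‖ + 1)) ^ N * ‖(((1 + ‖z‖) ^ N)⁻¹ : ℝ) • D z‖)
      (.of_forall fun y => hDm.mul (by fun_prop)) ?_ (hD.norm.const_mul _)
      (.of_forall fun z => by fun_prop)
    filter_upwards [Metric.ball_mem_nhds y₀ one_pos] with y hy
    refine .of_forall fun z => (hbound y z).trans ?_
    gcongr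
    have : ‖y - y₀‖ < 1 := by simpa [dist_eq_norm] using hy
    linarith [norm_le_norm_add_norm_sub' y y₀]
  · have hconv : T g = T (SchwartzMap.convolution (ContinuousLinearMap.mul ℂ ℂ) g χ) := by
      rw [hTapply, hTapply]
      congr 1
      ext ξ
      rw [SchwartzMap.smulLeftCLM_apply_apply hft, SchwartzMap.smulLeftCLM_apply_apply hft,
        SchwartzMap.fourier_convolution, SchwartzMap.pairing_apply_apply, hχF,
        ContinuousLinearMap.mul_apply', smul_eq_mul, smul_eq_mul, mul_left_comm, hχ', mul_comm]
    have hPT : v P = T g := by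
      rw [hTapply]
      congr 1
      ext ξ
      rw [hP, SchwartzMap.smulLeftCLM_apply_apply hft, smul_eq_mul]
    have hprod : Integrable (Function.uncurry fun z y => D z * (g y * χ (z - y)))
        ((volume : Measure E).prod (volume : Measure E)) := by
      have hdom := (hD.norm.const_mul B).mul_prod (integrable_one_add_pow_mul_norm g N)
      refine hdom.mono' ?_ (.of_forall fun p => ?_)
      · refine (hDm.comp_fst).mul ?_
        exact Continuous.aestronglyMeasurable (by fun_prop)
      · simp only [Function.uncurry]
        rw [mul_left_comm, norm_mul]
        calc ‖g p.2‖ * ‖D p.1 * χ (p.1 - p.2)‖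
            ≤ ‖g p.2‖ * (B * (1 + ‖p.2‖) ^ N * ‖(((1 + ‖p.1‖) ^ N)⁻¹ : ℝ) • D p.1‖) := by
              gcongr
              exact hbound _ _
          _ = _ := by ring
    have hinner : ∀ y, v (modulate y f) * g y = ∫ z, D z * (g y * χ (z - y)) := by
      intro y
      rw [hmod, ← integral_mul_const]
      congr 1
      ext z
      ring
    refine ⟨hprod.integral_prod_right.congr (.of_forall fun y => (hinner y).symm), ?_⟩
    rw [hPT, hconv, hrep]
    simp only [hinner]
    rw [← integral_integral_swap hprod]
    congr 1
    ext z
    rw [SchwartzMap.convolution_apply, MeasureTheory.convolution, ← integral_const_mul]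
    rfl

end Pairing

variable {d : ℕ}

/-! ### The dual action -/

theorem opNorm_nonneg (h : MatGL d) : 0 ≤ opNorm h := norm_nonneg _

theorem norm_linEquiv (h : MatGL d) : ‖(linEquiv h : Euc d →L[ℝ] Euc d)‖ = opNorm h := rfl

theorem linEquiv_symm (h : MatGL d) : (linEquiv h).symm = linEquiv h⁻¹ := by
  refine ContinuousLinearEquiv.ext (funext fun v => ?_)
  rw [ContinuousLinearEquiv.symm_apply_eq, linEquiv_apply, linEquiv_apply,
    ← mul_apply_eq_comp, ← map_mul, ← Units.val_mul, mul_inv_cancel]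
  simp

theorem dualAct_eq_adjoint (h : MatGL d) (ξ : Euc d) :
    dualAct h ξ = ContinuousLinearMap.adjoint (linEquiv h : Euc d →L[ℝ] Euc d) ξ := by
  have h1 : (h : Matrix (Fin d) (Fin d) ℝ).transpose = star (h : Matrix (Fin d) (Fin d) ℝ) := by
    rw [Matrix.star_eq_conjTranspose, Matrix.conjTranspose_eq_transpose_of_trivial]
  rw [dualAct, h1, map_star, ContinuousLinearMap.star_eq_adjoint]
  rfl

theorem inner_linEquiv (h : MatGL d) (v ξ : Euc d) :
    inner ℝ (linEquiv h v) ξ = inner ℝ v (dualAct h ξ) := by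
  rw [dualAct_eq_adjoint, ContinuousLinearMap.adjoint_inner_right]
  rfl

theorem norm_dualAct_le (h : MatGL d) (ξ : Euc d) : ‖dualAct h ξ‖ ≤ opNorm h * ‖ξ‖ := by
  rw [dualAct_eq_adjoint, ← norm_linEquiv, ← LinearIsometryEquiv.norm_map
    (ContinuousLinearMap.adjoint (𝕜 := ℝ) (E := Euc d) (F := Euc d)) (linEquiv h)]
  exact ContinuousLinearMap.le_opNorm _ _

theorem dualAct_mul (g h : MatGL d) (ξ : Euc d) :
    dualAct (g * h) ξ = dualAct h (dualAct g ξ) := by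
  simp only [dualAct]
  rw [← mul_apply_eq_comp, ← map_mul, ← Matrix.transpose_mul, Units.val_mul]

@[simp] theorem dualAct_one (ξ : Euc d) : dualAct (1 : MatGL d) ξ = ξ := by
  simp [dualAct]

@[simp] theorem dualAct_inv_dualAct (h : MatGL d) (ξ : Euc d) :
    dualAct h⁻¹ (dualAct h ξ) = ξ := by
  rw [← dualAct_mul, mul_inv_cancel, dualAct_one]

@[simp] theorem dualAct_dualAct_inv (h : MatGL d) (ξ : Euc d) :
    dualAct h (dualAct h⁻¹ ξ) = ξ := by
  rw [← dualAct_mul, inv_mul_cancel, dualAct_one]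

/-- The dual action as a linear homeomorphism. -/
def dualEquiv (h : MatGL d) : Euc d ≃L[ℝ] Euc d :=
  ContinuousLinearEquiv.equivOfInverse
    (Matrix.toEuclideanCLM (n := Fin d) (𝕜 := ℝ) (h : Matrix (Fin d) (Fin d) ℝ).transpose)
    (Matrix.toEuclideanCLM (n := Fin d) (𝕜 := ℝ)
      ((h⁻¹ : MatGL d) : Matrix (Fin d) (Fin d) ℝ).transpose)
    (dualAct_inv_dualAct h) (dualAct_dualAct_inv h)

@[simp] theorem dualEquiv_apply (h : MatGL d) (ξ : Euc d) : dualEquiv h ξ = dualAct h ξ := rfl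

theorem norm_dualEquiv_le (h : MatGL d) : ‖(dualEquiv h : Euc d →L[ℝ] Euc d)‖ ≤ opNorm h :=
  ContinuousLinearMap.opNorm_le_bound _ (opNorm_nonneg h) (norm_dualAct_le h)

theorem dualAct_sub (h : MatGL d) (ξ η : Euc d) :
    dualAct h (ξ - η) = dualAct h ξ - dualAct h η := map_sub (dualEquiv h) ξ η

theorem dualAct_smul (h : MatGL d) (r : ℝ) (ξ : Euc d) :
    dualAct h (r • ξ) = r • dualAct h ξ := map_smul (dualEquiv h) r ξ

theorem continuous_dualAct (h : MatGL d) : Continuous (dualAct h) := (dualEquiv h).continuous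

theorem opNorm_mul_le (g h : MatGL d) : opNorm (g * h) ≤ opNorm g * opNorm h := by
  unfold opNorm
  rw [Units.val_mul, map_mul]
  exact norm_mul_le _ _

theorem opNorm_pos [Nontrivial (Euc d)] (h : MatGL d) : 0 < opNorm h := by
  obtain ⟨ξ, hξ⟩ := exists_ne (0 : Euc d)
  by_contra hcon
  have h0 : opNorm h = 0 := le_antisymm (not_lt.mp hcon) (opNorm_nonneg h)
  have h1 := norm_dualAct_le h (dualAct h⁻¹ ξ)
  rw [dualAct_dualAct_inv, h0, zero_mul] at h1
  exact hξ (norm_le_zero_iff.mp h1)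

/-! ### Determinants and the change of variables under dilations. -/

/-- The absolute value of the determinant. -/
abbrev absDet (h : MatGL d) : ℝ := |(h : Matrix (Fin d) (Fin d) ℝ).det|

theorem abs_det_le (h : MatGL d) :
    absDet h ≤ d.factorial * opNorm h ^ d := by
  have key : ∀ i j, (AbsoluteValue.abs : AbsoluteValue ℝ ℝ)
      ((h : Matrix (Fin d) (Fin d) ℝ) i j) ≤ opNorm h := by
    intro i j
    have h1 : (h : Matrix (Fin d) (Fin d) ℝ) i j =
        linEquiv h (EuclideanSpace.single j 1) i := by
      rw [linEquiv_apply]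
      simp [Matrix.ofLp_toEuclideanCLM]
    have h2 := (linEquiv h : Euc d →L[ℝ] Euc d).le_opNorm (EuclideanSpace.single j 1)
    rw [AbsoluteValue.abs_apply, h1, ← Real.norm_eq_abs]
    refine (PiLp.norm_apply_le _ i).trans (h2.trans ?_)
    simp [norm_linEquiv]
  simpa using Matrix.det_le (abv := AbsoluteValue.abs) key

theorem abs_det_pos (h : MatGL d) : 0 < absDet h :=
  abs_pos.mpr ((Matrix.isUnit_iff_isUnit_det _).mp h.isUnit).ne_zero

theorem inv_abs_det_le (h : MatGL d) :
    (absDet h)⁻¹ ≤ d.factorial * opNorm h⁻¹ ^ d := by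
  refine le_trans (le_of_eq ?_) (abs_det_le h⁻¹)
  rw [absDet, absDet, Matrix.coe_units_inv, Matrix.det_nonsing_inv, Ring.inverse_eq_inv', abs_inv]

theorem det_linEquiv (h : MatGL d) :
    LinearMap.det ((linEquiv h : Euc d →L[ℝ] Euc d) : Euc d →ₗ[ℝ] Euc d) =
      (h : Matrix (Fin d) (Fin d) ℝ).det := by
  have : ((linEquiv h : Euc d →L[ℝ] Euc d) : Euc d →ₗ[ℝ] Euc d) =
      Matrix.toLin (EuclideanSpace.basisFun (Fin d) ℝ).toBasis
        (EuclideanSpace.basisFun (Fin d) ℝ).toBasis (h : Matrix (Fin d) (Fin d) ℝ) := by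
    rw [← Matrix.toEuclideanLin_eq_toLin_orthonormal]
    rfl
  rw [this, LinearMap.det_toLin]

theorem integral_comp_linEquiv_inv (h : MatGL d) (f : Euc d → ℂ) :
    ∫ v, f (linEquiv h⁻¹ v) =
      ((absDet h : ℝ) : ℂ) * ∫ v, f v := by
  have hdet : LinearMap.det ((linEquiv h : Euc d →L[ℝ] Euc d) : Euc d →ₗ[ℝ] Euc d) ≠ 0 := by
    rw [det_linEquiv]
    exact abs_pos.mp (abs_det_pos h)
  have hmap := Measure.map_linearMap_addHaar_eq_smul_addHaar (volume : Measure (Euc d)) hdet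
  have hemb : MeasurableEmbedding (linEquiv h) := (linEquiv h).toHomeomorph.measurableEmbedding
  have h1 := hemb.integral_map (μ := volume) (fun v => f (linEquiv h⁻¹ v))
  have h2 : (⇑((linEquiv h : Euc d →L[ℝ] Euc d) : Euc d →ₗ[ℝ] Euc d)) = linEquiv h := rfl
  rw [h2, det_linEquiv] at hmap
  rw [hmap, integral_smul_measure] at h1
  simp only [← linEquiv_symm, ContinuousLinearEquiv.symm_apply_apply] at h1 ⊢
  rw [← h1, ENNReal.toReal_ofReal (abs_nonneg _), abs_inv, Complex.real_smul, ← mul_assoc,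
    ← Complex.ofReal_mul, mul_inv_cancel₀ (abs_det_pos h).ne', Complex.ofReal_one, one_mul]

/-! ### Dilations and the Fourier transform -/

/-- `f ∘ h⁻¹`. -/
def dilate (h : MatGL d) (f : 𝓢(Euc d, ℂ)) : 𝓢(Euc d, ℂ) :=
  SchwartzMap.compCLMOfContinuousLinearEquiv ℂ (linEquiv h⁻¹) f

/-- `f ∘ hᵀ`. -/
def dualDilate (h : MatGL d) (f : 𝓢(Euc d, ℂ)) : 𝓢(Euc d, ℂ) :=
  SchwartzMap.compCLMOfContinuousLinearEquiv ℂ (dualEquiv h) f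

@[simp] theorem dilate_apply (h : MatGL d) (f : 𝓢(Euc d, ℂ)) (z : Euc d) :
    dilate h f z = f (linEquiv h⁻¹ z) := rfl

@[simp] theorem dualDilate_apply (h : MatGL d) (f : 𝓢(Euc d, ℂ)) (z : Euc d) :
    dualDilate h f z = f (dualAct h z) := rfl

theorem fourier_dilate_apply (h : MatGL d) (f : 𝓢(Euc d, ℂ)) (ξ : Euc d) :
    𝓕 (dilate h f) ξ = ((absDet h : ℝ) : ℂ) * 𝓕 f (dualAct h ξ) := by
  rw [SchwartzMap.fourier_coe, SchwartzMap.fourier_coe, Real.fourier_eq, Real.fourier_eq,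
    ← integral_comp_linEquiv_inv]
  congr 1
  ext v
  rw [← inner_linEquiv, ← linEquiv_symm, ContinuousLinearEquiv.apply_symm_apply, dilate_apply,
    linEquiv_symm]

theorem fourierInv_conjS (f : 𝓢(Euc d, ℂ)) : 𝓕⁻ (conjS f) = conjS (𝓕 f) := by
  ext ξ
  rw [conjS_apply, SchwartzMap.fourier_coe, SchwartzMap.fourierInv_coe, Real.fourier_eq,
    Real.fourierInv_eq, ← integral_conj]
  congr 1
  ext v
  rw [conjS_apply, Circle.smul_def, Circle.smul_def, smul_eq_mul, smul_eq_mul, map_mul]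
  congr 1
  rw [AddChar.map_neg_eq_inv, Circle.coe_inv_eq_conj, Complex.conj_conj]

theorem conjS_quasiRegular (y : Euc d) (h : MatGL d) (ψ : 𝓢(Euc d, ℂ)) :
    conjS (quasiRegular y h ψ) =
      ((absDet h ^ (-(1 / 2) : ℝ) : ℝ) : ℂ) •
        SchwartzMap.compSubConstCLM ℂ y (dilate h (conjS ψ)) := by
  ext z
  rw [conjS_apply, quasiRegular_apply, map_mul, Complex.conj_ofReal, smul_apply,
    SchwartzMap.compSubConstCLM_apply, dilate_apply, conjS_apply, smul_eq_mul]

/-- The Fourier transform of a dilate contributes a factor `absDet h`, which turns the exponent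
`-1/2` into `1/2`. -/
theorem conjS_quasiRegular_eq_fourier (y : Euc d) (h : MatGL d) (ψ : 𝓢(Euc d, ℂ)) :
    conjS (quasiRegular y h ψ) =
      𝓕 (((absDet h ^ (1 / 2 : ℝ) : ℝ) : ℂ) •
        modulate (-y) (dualDilate h (conjS (𝓕 ψ)))) := by
  have h0 : conjS (quasiRegular y h ψ) = 𝓕 (𝓕⁻ (conjS (quasiRegular y h ψ))) :=
    (FourierTransform.fourier_fourierInv_eq _).symm
  rw [h0, fourierInv_conjS]
  congr 1
  ext ξ
  have hq : quasiRegular y h ψ = ((absDet h ^ (-(1 / 2) : ℝ) : ℝ) : ℂ) •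
      SchwartzMap.compSubConstCLM ℂ y (dilate h ψ) := rfl
  have hdet : (absDet h ^ (-(1 / 2) : ℝ)) *
      absDet h = absDet h ^ (1 / 2 : ℝ) := by
    rw [← Real.rpow_add_one (abs_det_pos h).ne']
    norm_num
  rw [conjS_apply, hq, FourierTransform.fourier_smul, smul_apply,
    smul_apply, fourier_compSubConst_apply, fourier_dilate_apply, modulate_apply,
    dualDilate_apply, conjS_apply, smul_eq_mul, smul_eq_mul, map_mul, map_mul, map_mul,
    Complex.conj_ofReal, Complex.conj_ofReal, ← hdet, inner_neg_left, neg_neg,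
    AddChar.map_neg_eq_inv, Circle.coe_inv_eq_conj, Complex.conj_conj, Complex.ofReal_mul]
  ring

theorem waveletTransform_eq (ψ : 𝓢(Euc d, ℂ)) (u : 𝓢'(Euc d, ℂ)) (y : Euc d) (h : MatGL d) :
    waveletTransform ψ u y h = ((absDet h ^ (1 / 2 : ℝ) : ℝ) : ℂ) *
      (𝓕 u) (modulate (-y) (dualDilate h (conjS (𝓕 ψ)))) := by
  rw [waveletTransform, conjS_quasiRegular_eq_fourier, FourierTransform.fourier_smul, map_smul,
    smul_eq_mul, TemperedDistribution.fourier_apply]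

/-! ### Orbits -/

section Orbit

variable {H : Subgroup (MatGL d)} {ξ₀ : Euc d}

theorem exists_dualAct_eq {ξ η : Euc d} (hξ : ξ ∈ dualOrbit H ξ₀) (hη : η ∈ dualOrbit H ξ₀) :
    ∃ h ∈ H, dualAct h ξ = η := by
  obtain ⟨a, ha, rfl⟩ := hξ
  obtain ⟨b, hb, rfl⟩ := hη
  exact ⟨a⁻¹ * b, H.mul_mem (H.inv_mem ha) hb, by rw [dualAct_mul, dualAct_inv_dualAct]⟩

theorem dualAct_mem_dualOrbit {ξ : Euc d} {h : MatGL d} (hh : h ∈ H)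
    (hξ : ξ ∈ dualOrbit H ξ₀) : dualAct h ξ ∈ dualOrbit H ξ₀ := by
  obtain ⟨a, ha, rfl⟩ := hξ
  exact ⟨a * h, H.mul_mem ha hh, dualAct_mul a h ξ₀⟩

/-- If one scaling of an orbit meets the orbit, then it preserves the orbit. -/
theorem smul_mem_dualOrbit_iff {η ζ : Euc d} (r : ℝ) (hη : η ∈ dualOrbit H ξ₀)
    (hζ : ζ ∈ dualOrbit H ξ₀) : r • η ∈ dualOrbit H ξ₀ ↔ r • ζ ∈ dualOrbit H ξ₀ := by
  obtain ⟨h, hh, rfl⟩ := exists_dualAct_eq hη hζ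
  rw [← dualAct_smul]
  refine ⟨dualAct_mem_dualOrbit hh, fun hm => ?_⟩
  simpa using dualAct_mem_dualOrbit (H.inv_mem hh) hm

/-- An open orbit is a cone. -/
theorem smul_mem_dualOrbit (hopen : IsOpen (dualOrbit H ξ₀)) {ξ : Euc d}
    (hξ : ξ ∈ dualOrbit H ξ₀) {r : ℝ} (hr : 0 < r) : r • ξ ∈ dualOrbit H ξ₀ := by
  -- Scalings are written as `exp t`, so that connectedness of `ℝ` applies once `S` is shown to be
  -- open and closed.
  set S : Set ℝ := {t | Real.exp t • ξ ∈ dualOrbit H ξ₀} with hS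
  have hSopen : IsOpen S := hopen.preimage (by fun_prop)
  have hSc : IsOpen Sᶜ := by
    rw [isOpen_iff_mem_nhds]
    intro t ht
    -- For `s` near `t` the vector `exp (s - t) • ξ` stays in the orbit. If `exp s • ξ` were in it
    -- too, scaling by `exp t` would send one orbit point into the orbit, hence all of them, `ξ`
    -- included.
    have hnh : (fun s : ℝ => Real.exp (s - t) • ξ) ⁻¹' dualOrbit H ξ₀ ∈ 𝓝 t :=
      (hopen.preimage (by fun_prop)).mem_nhds (by simpa using hξ)
    filter_upwards [hnh] with s hs hsS
    refine ht ?_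
    have h1 : Real.exp s • ξ = Real.exp t • (Real.exp (s - t) • ξ) := by
      rw [smul_smul, ← Real.exp_add, add_sub_cancel]
    rw [hS, Set.mem_ofPred_eq, h1] at hsS
    exact (smul_mem_dualOrbit_iff (Real.exp t) hs hξ).mp hsS
  have huniv : S = Set.univ :=
    IsClopen.eq_univ ⟨⟨hSc⟩, hSopen⟩ ⟨0, by simpa [hS] using hξ⟩
  have : Real.log r ∈ S := huniv ▸ Set.mem_univ _
  rwa [hS, Set.mem_ofPred_eq, Real.exp_log hr] at this

/-- The action is linear, so an orbit through `0` is `{0}`. -/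
theorem zero_notMem_dualOrbit {ξ : Euc d} (hξ : ξ ∈ dualOrbit H ξ₀) (hne : ξ ≠ 0) :
    (0 : Euc d) ∉ dualOrbit H ξ₀ := by
  intro h0
  obtain ⟨h, -, hh⟩ := exists_dualAct_eq h0 hξ
  exact hne (hh ▸ map_zero (dualEquiv h))

end Orbit

/-! ### Cones and directions -/

theorem IsDirNhd.inter {ξ : Euc d} {W W' : Set (Euc d)} (h : IsDirNhd ξ W) (h' : IsDirNhd ξ W') :
    IsDirNhd ξ (W ∩ W') := by
  obtain ⟨hm, A, hA, rfl⟩ := h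
  obtain ⟨hm', A', hA', rfl⟩ := h'
  exact ⟨⟨hm, hm'⟩, A ∩ A', hA.inter hA', by ext; simp; tauto⟩

theorem smul_mem_cone {W : Set (Euc d)} {r : ℝ} (hr : 0 < r) {η : Euc d} :
    r • η ∈ cone W ↔ η ∈ cone W := by
  simp only [cone, Set.mem_ofPred_eq, smul_ne_zero_iff, ne_eq, hr.ne', not_false_eq_true, true_and]
  rw [norm_smul, Real.norm_of_nonneg hr.le, mul_inv, smul_smul, mul_assoc, mul_comm (‖η‖⁻¹),
    ← mul_assoc, inv_mul_cancel₀ hr.ne', one_mul]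

theorem cone_subset_dualOrbit {H : Subgroup (MatGL d)} {ξ₀ : Euc d}
    (hopen : IsOpen (dualOrbit H ξ₀)) {W : Set (Euc d)} (hW : W ⊆ dualOrbit H ξ₀) :
    cone W ⊆ dualOrbit H ξ₀ := by
  rintro η ⟨hη, hm⟩
  have := smul_mem_dualOrbit hopen (hW hm) (norm_pos_iff.mpr hη)
  rwa [smul_smul, mul_inv_cancel₀ (norm_ne_zero_iff.mpr hη), one_smul] at this

theorem cone_mono {W W' : Set (Euc d)} (h : W ⊆ W') : cone W ⊆ cone W' :=
  fun _ hη => ⟨hη.1, h hη.2⟩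

theorem truncCone_mono {W W' : Set (Euc d)} (h : W ⊆ W') {R R' : ℝ} (hR : R' ≤ R) :
    truncCone W R ⊆ truncCone W' R' :=
  Set.sdiff_subset_sdiff (cone_mono h) (Metric.closedBall_subset_closedBall hR)

theorem outerK_mono {H : Subgroup (MatGL d)} {W W' V : Set (Euc d)} (h : W ⊆ W') {R R' : ℝ}
    (hR : R' ≤ R) : outerK H W V R ⊆ outerK H W' V R' :=
  fun _ hh => hh.mono (Set.inter_subset_inter_right _ (truncCone_mono h hR))

theorem mem_outerK {H : Subgroup (MatGL d)} {W V : Set (Euc d)} {R : ℝ} {h : H} {v : Euc d}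
    (hv : v ∈ V) (hW : dualAct (h : MatGL d)⁻¹ v ∈ cone W)
    (hR : R < ‖dualAct (h : MatGL d)⁻¹ v‖) : h ∈ outerK H W V R :=
  ⟨_, ⟨v, hv, rfl⟩, hW, by simpa using hR⟩

/-! ### Transport of the hypotheses along the orbit. -/

/-- The unit vectors which the dual action of `g` maps into the cone over `W`. -/
def dirPull (g : MatGL d) (W : Set (Euc d)) : Set (Euc d) :=
  {s | dualAct g s ∈ cone W} ∩ Metric.sphere 0 1

theorem mem_cone_dirPull {g : MatGL d} {W : Set (Euc d)} {ζ : Euc d} :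
    ζ ∈ cone (dirPull g W) ↔ dualAct g ζ ∈ cone W := by
  constructor
  · rintro ⟨hζ, hm, -⟩
    rw [Set.mem_ofPred_eq, dualAct_smul, smul_mem_cone (by positivity)] at hm
    exact hm
  · intro hm
    have hζ : ζ ≠ 0 := by
      rintro rfl
      exact hm.1 (map_zero (dualEquiv g))
    refine ⟨hζ, ?_, ?_⟩
    · rwa [Set.mem_ofPred_eq, dualAct_smul, smul_mem_cone (by positivity)]
    · simp [norm_smul, hζ]

theorem dualAct_mem_truncCone {g : MatGL d} {W : Set (Euc d)} {ζ : Euc d} {R : ℝ}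
    (hζ : ζ ∈ truncCone (dirPull g W) (opNorm g⁻¹ * R)) : dualAct g ζ ∈ truncCone W R := by
  refine ⟨mem_cone_dirPull.mp hζ.1, fun hR => hζ.2 ?_⟩
  rw [mem_closedBall_zero_iff] at hR ⊢
  have := norm_dualAct_le g⁻¹ (dualAct g ζ)
  rw [dualAct_inv_dualAct] at this
  exact this.trans (mul_le_mul_of_nonneg_left hR (opNorm_nonneg _))

theorem isOpen_cone_inter {A : Set (Euc d)} (hA : IsOpen A) :
    IsOpen (cone (A ∩ Metric.sphere 0 1)) := by
  have hc : ContinuousOn (fun η : Euc d => ‖η‖⁻¹ • η) {0}ᶜ :=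
    (continuousOn_id.norm.inv₀ fun η hη => norm_ne_zero_iff.mpr hη).smul continuousOn_id
  have := hc.isOpen_inter_preimage isOpen_compl_singleton hA
  convert this using 1
  ext η
  simp only [cone, Set.mem_ofPred_eq, Set.mem_inter_iff, Set.mem_compl_iff, Set.mem_singleton_iff,
    Set.mem_preimage]
  refine ⟨fun h => ⟨h.1, h.2.1⟩, fun h => ⟨h.1, h.2, ?_⟩⟩
  simp [norm_smul, h.1]

theorem mem_cone_of_mem_sphere {W : Set (Euc d)} {ξ : Euc d} (hξ : ξ ∈ W)
    (h1 : ξ ∈ Metric.sphere (0 : Euc d) 1) : ξ ∈ cone W := by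
  rw [mem_sphere_zero_iff_norm] at h1
  exact ⟨norm_ne_zero_iff.mp (by simp [h1]), by simpa [h1] using hξ⟩

theorem IsDirNhd.dirPull {ξ η : Euc d} {W : Set (Euc d)} (hW : IsDirNhd ξ W) {g : MatGL d}
    (hg : dualAct g η = ξ) (hη : η ∈ Metric.sphere (0 : Euc d) 1) : IsDirNhd η (dirPull g W) := by
  obtain ⟨hm, A, hA, rfl⟩ := hW
  refine ⟨⟨?_, hη⟩, _, (isOpen_cone_inter hA).preimage (continuous_dualAct g), rfl⟩
  rw [Set.mem_ofPred_eq, hg]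
  exact mem_cone_of_mem_sphere hm hm.2

theorem dirPull_subset {H : Subgroup (MatGL d)} {ξ₀ : Euc d} (hopen : IsOpen (dualOrbit H ξ₀))
    {W : Set (Euc d)} (hW : W ⊆ dualOrbit H ξ₀) {g : MatGL d} (hg : g ∈ H) :
    dirPull g W ⊆ dualOrbit H ξ₀ := by
  intro s hs
  simpa using dualAct_mem_dualOrbit (H.inv_mem hg) (cone_subset_dualOrbit hopen hW hs.1)

/-- Since `(gh)⁻ᵀ = g⁻ᵀ h⁻ᵀ`, left multiplication by `g` moves the cone by `g⁻ᵀ`; the radius is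
enlarged by `‖g‖` because `g⁻ᵀ` shrinks vectors by at most that factor. -/
theorem mul_mem_outerK {H : Subgroup (MatGL d)} {W V : Set (Euc d)} {R : ℝ} {g h : H}
    (hh : h ∈ outerK H (dirPull (g : MatGL d)⁻¹ W) V (opNorm (g : MatGL d) * R)) :
    g * h ∈ outerK H W V R := by
  obtain ⟨-, ⟨v, hv, rfl⟩, hc⟩ := hh
  refine ⟨_, ⟨v, hv, rfl⟩, ?_⟩
  rw [Subgroup.coe_mul, mul_inv_rev, dualAct_mul]
  exact dualAct_mem_truncCone (by rwa [inv_inv])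

/-- The cone approximation property spreads along the orbit. -/
theorem ConeApproximation.transfer {H : Subgroup (MatGL d)} {ξ₀ ξ₁ ξ : Euc d} {V : Set (Euc d)}
    (hopen : IsOpen (dualOrbit H ξ₀)) (hc : ConeApproximation H (dualOrbit H ξ₀) V ξ₁)
    [Nontrivial (Euc d)]
    (hξ₁ : ξ₁ ∈ dualOrbit H ξ₀ ∩ Metric.sphere 0 1) (hξ : ξ ∈ dualOrbit H ξ₀ ∩ Metric.sphere 0 1) :
    ConeApproximation H (dualOrbit H ξ₀) V ξ := by
  intro W hW hWO R hR
  obtain ⟨g, hg, hgξ⟩ := exists_dualAct_eq hξ₁.1 hξ.1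
  have hgξ' : dualAct g⁻¹ ξ = ξ₁ := by rw [← hgξ, dualAct_inv_dualAct]
  obtain ⟨R', hR', W', hW', hW'O, hsub⟩ := hc (dirPull g W) (hW.dirPull hgξ hξ₁.2)
    (dirPull_subset hopen hWO hg) (opNorm g⁻¹ * R) (mul_pos (opNorm_pos _) hR)
  refine ⟨opNorm g * R', mul_pos (opNorm_pos _) hR', dirPull g⁻¹ W', hW'.dirPull hgξ' hξ.2,
    dirPull_subset hopen hW'O (H.inv_mem hg), fun h hh => ?_⟩
  have hmem := hsub (mul_mem_outerK (g := ⟨g, hg⟩) hh)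
  -- Undo the factor `g`: applying `gᵀ` to `g⁻ᵀ h⁻ᵀ v` returns `h⁻ᵀ v`, and the radius `‖g⁻¹‖ R`
  -- becomes `R`.
  rintro - ⟨v, hv, rfl⟩
  have hv' := hmem ⟨v, hv, rfl⟩
  rw [Subgroup.coe_mul, mul_inv_rev, dualAct_mul] at hv'
  simpa using dualAct_mem_truncCone hv'

/-- The inverse norm estimate spreads along the orbit. -/
theorem InverseNormEstimate.transfer {H : Subgroup (MatGL d)} {ξ₀ ξ₁ ξ : Euc d} {V : Set (Euc d)}
    (hopen : IsOpen (dualOrbit H ξ₀)) (hi : InverseNormEstimate H (dualOrbit H ξ₀) V ξ₁)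
    [Nontrivial (Euc d)]
    (hξ₁ : ξ₁ ∈ dualOrbit H ξ₀ ∩ Metric.sphere 0 1) (hξ : ξ ∈ dualOrbit H ξ₀ ∩ Metric.sphere 0 1) :
    InverseNormEstimate H (dualOrbit H ξ₀) V ξ := by
  obtain ⟨g, hg, hgξ⟩ := exists_dualAct_eq hξ₁.1 hξ.1
  have hgξ' : dualAct g⁻¹ ξ = ξ₁ := by rw [← hgξ, dualAct_inv_dualAct]
  obtain ⟨W, hW, hWO, R, hR, α, hα, C, hC, hest⟩ := hi
  have hgpos := opNorm_pos g
  have hgpos' := opNorm_pos g⁻¹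
  refine ⟨dirPull g⁻¹ W, hW.dirPull hgξ' hξ.2, dirPull_subset hopen hWO (H.inv_mem hg),
    opNorm g * R, mul_pos hgpos hR, α, hα, C * opNorm g * opNorm g⁻¹ ^ α, by positivity,
    fun h hh => ?_⟩
  have h1 := hest _ (mul_mem_outerK (g := ⟨g, hg⟩) hh)
  rw [Subgroup.coe_mul] at h1
  set k := (h : MatGL d)
  have hk := opNorm_pos k
  have hgk := opNorm_pos (g * k)
  have e1 : opNorm k⁻¹ ≤ opNorm (g * k)⁻¹ * opNorm g := by
    refine le_trans (le_of_eq ?_) (opNorm_mul_le _ _)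
    rw [mul_inv_rev, inv_mul_cancel_right]
  have e2 : opNorm k ≤ opNorm g⁻¹ * opNorm (g * k) := by
    refine le_trans (le_of_eq ?_) (opNorm_mul_le _ _)
    rw [inv_mul_cancel_left]
  have e3 : opNorm (g * k) ^ (-α) ≤ opNorm g⁻¹ ^ α * opNorm k ^ (-α) := by
    rw [Real.rpow_neg hgk.le, Real.rpow_neg hk.le, ← div_eq_mul_inv,
      le_div_iff₀ (by positivity), inv_mul_le_iff₀ (by positivity), mul_comm,
      ← Real.mul_rpow hgpos'.le hgk.le]
    exact Real.rpow_le_rpow hk.le e2 hα.le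
  calc opNorm k⁻¹ ≤ (C * opNorm (g * k) ^ (-α)) * opNorm g := e1.trans (by gcongr)
    _ ≤ (C * (opNorm g⁻¹ ^ α * opNorm k ^ (-α))) * opNorm g := by gcongr
    _ = _ := by ring

/-- On a suitable `outerK`, the norm is bounded, and the norm of the inverse grows at most
polynomially in the reciprocal of the norm. -/
theorem InverseNormEstimate.exists_bounds {H : Subgroup (MatGL d)} {O V : Set (Euc d)} {ξ : Euc d}
    [Nontrivial (Euc d)] (hi : InverseNormEstimate H O V ξ) {M : ℝ} (hM : ∀ v ∈ V, ‖v‖ ≤ M) :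
    ∃ W₀, IsDirNhd ξ W₀ ∧ W₀ ⊆ O ∧ ∃ R₀ : ℝ, 0 < R₀ ∧ ∃ (m : ℕ) (A B : ℝ), ∀ h ∈ outerK H W₀ V R₀,
      opNorm (h : MatGL d) ≤ B ∧
      opNorm (h : MatGL d)⁻¹ * opNorm (h : MatGL d) ^ m ≤ A := by
  obtain ⟨W, hW, hWO, R, hR, α, hα, C, hC, hest⟩ := hi
  -- For `h` in `K_o` some `v ∈ V` has `R < ‖h⁻ᵀ v‖ ≤ C ‖h‖ ^ (-α) M`, which bounds `‖h‖`. Rounding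
  -- `α` up leaves the nonnegative exponent `⌈α⌉ - α`, so this bound also controls the second
  -- quantity.
  refine ⟨W, hW, hWO, R, hR, ⌈α⌉₊, C * ((C * M / R) ^ (α⁻¹)) ^ ((⌈α⌉₊ : ℝ) - α),
    (C * M / R) ^ (α⁻¹), fun h hh => ?_⟩
  have h1 := hest h hh
  obtain ⟨-, ⟨v, hv, rfl⟩, -, hRv⟩ := hh
  set k := (h : MatGL d)
  have hk := opNorm_pos k
  rw [mem_closedBall_zero_iff, not_le] at hRv
  have hM0 : 0 ≤ M := (norm_nonneg v).trans (hM v hv)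
  have h2 : opNorm k ^ α ≤ C * M / R := by
    have h3 : R ≤ (C * opNorm k ^ (-α)) * M :=
      hRv.le.trans ((norm_dualAct_le _ _).trans (mul_le_mul h1 (hM v hv) (norm_nonneg _)
        (by positivity)))
    rw [Real.rpow_neg hk.le] at h3
    rw [le_div_iff₀ hR]
    have hp : 0 < opNorm k ^ α := by positivity
    calc opNorm k ^ α * R ≤ opNorm k ^ α * (C * (opNorm k ^ α)⁻¹ * M) := by gcongr
      _ = C * M := by field_simp
  have hB : opNorm k ≤ (C * M / R) ^ (α⁻¹) := by
    rw [Real.le_rpow_inv_iff_of_pos hk.le (by positivity) hα]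
    exact h2
  refine ⟨hB, ?_⟩
  calc opNorm k⁻¹ * opNorm k ^ ⌈α⌉₊ ≤ (C * opNorm k ^ (-α)) * opNorm k ^ ⌈α⌉₊ := by gcongr
    _ = C * opNorm k ^ ((⌈α⌉₊ : ℝ) - α) := by
        rw [← Real.rpow_natCast, mul_assoc, ← Real.rpow_add hk]
        ring_nf
    _ ≤ _ := by
        gcongr
        exact sub_nonneg.mpr (Nat.le_ceil α)

/-! ### Regular directed points have rapidly decaying wavelet transform -/

/-- On `K`, the norm is bounded and the norm of the inverse is polynomially bounded in the
reciprocal of the norm. -/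
def NormBounds (K : Set (MatGL d)) (m : ℕ) (A B : ℝ) : Prop :=
  ∀ h ∈ K, opNorm h ≤ B ∧ opNorm h⁻¹ * opNorm h ^ m ≤ A

theorem NormBounds.exists_inv_absDet_mul_le {K : Set (MatGL d)} {m : ℕ} {A B : ℝ}
    (hK : NormBounds K m A B) : ∃ C : ℝ, ∀ h ∈ K, (absDet h)⁻¹ * opNorm h ^ (m * d) ≤ C := by
  refine ⟨d.factorial * A ^ d, fun h hh => ?_⟩
  have h0 := opNorm_nonneg h
  have h1 := opNorm_nonneg h⁻¹
  calc (absDet h)⁻¹ * opNorm h ^ (m * d)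
      ≤ (d.factorial * opNorm h⁻¹ ^ d) * opNorm h ^ (m * d) := by
        gcongr
        exact inv_abs_det_le h
    _ = d.factorial * (opNorm h⁻¹ * opNorm h ^ m) ^ d := by rw [pow_mul, mul_pow]; ring
    _ ≤ _ := by
        gcongr
        exact (hK h hh).2

/-- Lets the bound on the inverse determinant serve also for its square root, with no case split on
the size of the determinant. -/
theorem rpow_neg_half_le_one_add_inv {x : ℝ} (hx : 0 < x) : x ^ (-(1 / 2) : ℝ) ≤ 1 + x⁻¹ := by
  rcases le_total 1 x with h | h
  · exact (Real.rpow_le_one_of_one_le_of_nonpos h (by norm_num)).trans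
      (le_add_of_nonneg_right (by positivity))
  · have : x ^ (-(1 / 2) : ℝ) ≤ x ^ (-1 : ℝ) :=
      Real.rpow_le_rpow_of_exponent_ge hx h (by norm_num)
    rw [Real.rpow_neg_one] at this
    linarith

theorem NormBounds.exists_rpow_absDet_mul_le {K : Set (MatGL d)} {m : ℕ} {A B : ℝ}
    (hK : NormBounds K m A B) :
    ∃ C : ℝ, ∀ h ∈ K, absDet h ^ (-(1 / 2) : ℝ) * opNorm h ^ (m * d) ≤ C := by
  obtain ⟨C, hC⟩ := hK.exists_inv_absDet_mul_le
  refine ⟨B ^ (m * d) + C, fun h hh => ?_⟩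
  have h0 := opNorm_nonneg h
  calc absDet h ^ (-(1 / 2) : ℝ) * opNorm h ^ (m * d)
      ≤ (1 + (absDet h)⁻¹) * opNorm h ^ (m * d) := by
        gcongr
        exact rpow_neg_half_le_one_add_inv (abs_det_pos h)
    _ = opNorm h ^ (m * d) + (absDet h)⁻¹ * opNorm h ^ (m * d) := by ring
    _ ≤ _ := by
        gcongr
        · exact (hK h hh).1
        · exact hC h hh

/-- If `𝓕 T` is a function which decays rapidly on a cone containing all `h⁻ᵀ V`, then the wavelet
transform of `T` decays rapidly. -/
theorem exists_waveletTransform_le_of_decay {T : 𝓢'(Euc d, ℂ)} {F : Euc d → ℂ}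
    (hF : IsContinuousFunction (𝓕 T) F) {W V : Set (Euc d)}
    (hdec : ∀ N : ℕ, ∃ C : ℝ, 0 < C ∧ ∀ η ∈ cone W, ‖F η‖ ≤ C * ((1 + ‖η‖) ^ N)⁻¹)
    {K : Set (MatGL d)} {B c : ℝ} (hc : 0 < c) (hV : ∀ v ∈ V, c ≤ ‖v‖)
    (hK : ∀ h ∈ K, opNorm h ≤ B) (hKV : ∀ h ∈ K, ∀ v ∈ V, dualAct h⁻¹ v ∈ cone W)
    {ψ : 𝓢(Euc d, ℂ)} (hψ : ∀ η, 𝓕 ψ η ≠ 0 → η ∈ V) (N : ℕ) :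
    ∃ C : ℝ, 0 ≤ C ∧ ∀ y, ∀ h ∈ K, ‖waveletTransform ψ T y h‖ ≤ C * opNorm h ^ N := by
  obtain ⟨n, hn⟩ := Measure.HasTemperateGrowth.exists_integrable (μ := (volume : Measure (Euc d)))
  have hnr : ∀ η : Euc d, (1 + ‖η‖) ^ (-(n : ℝ)) = ((1 + ‖η‖) ^ n)⁻¹ := fun η => by
    rw [Real.rpow_neg (by positivity), Real.rpow_natCast]
  simp only [hnr] at hn
  -- Of the decay of order `N + n`, the part `n` makes the integral converge and the part `N`
  -- becomes `‖h‖ ^ N`.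
  obtain ⟨C, hC0, hC⟩ := hdec (N + n)
  set f := conjS (𝓕 ψ) with hf
  set S := SchwartzMap.seminorm ℂ 0 0 f with hS
  set I := ∫ η : Euc d, ((1 + ‖η‖) ^ n)⁻¹ with hI
  have hI0 : 0 ≤ I := integral_nonneg fun η => by positivity
  have hS0 : 0 ≤ S := apply_nonneg _ _
  refine ⟨(d.factorial * max B 0 ^ d) ^ (1 / 2 : ℝ) * (C * S * c⁻¹ ^ N * I), by positivity,
    fun y h hh => ?_⟩
  have hh0 := opNorm_nonneg h
  rw [waveletTransform_eq, (hF.2 _).2, norm_mul, Complex.norm_real,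
    Real.norm_of_nonneg (by positivity), mul_assoc]
  gcongr
  · refine (abs_det_le h).trans ?_
    gcongr
    exact (hK h hh).trans (le_max_left _ _)
  · have hpt : ∀ η, ‖F η * modulate (-y) (dualDilate h f) η‖ ≤
        (C * S * c⁻¹ ^ N * opNorm h ^ N) * ((1 + ‖η‖) ^ n)⁻¹ := by
      intro η
      rw [modulate_apply, norm_mul, norm_mul, Circle.norm_coe, one_mul, dualDilate_apply]
      by_cases h0 : f (dualAct h η) = 0
      · rw [h0, norm_zero, mul_zero]
        positivity
      · have hv : dualAct h η ∈ V := hψ _ fun h1 => h0 (by rw [hf, conjS_apply, h1, map_zero])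
        have hη : η ∈ cone W := by simpa using hKV h hh _ hv
        -- `V` stays at distance `c` from `0`, so only frequencies with `‖η‖ ≥ c / ‖h‖` contribute.
        have h1 : c ≤ opNorm h * ‖η‖ := (hV _ hv).trans (norm_dualAct_le h η)
        have h2 : ((1 + ‖η‖) ^ N)⁻¹ ≤ (c⁻¹ * opNorm h) ^ N := by
          rw [← inv_pow]
          gcongr
          rw [inv_mul_eq_div, le_div_iff₀ hc, inv_mul_le_iff₀ (by positivity)]
          nlinarith [norm_nonneg η]
        calc ‖F η‖ * ‖f (dualAct h η)‖ ≤ (C * ((1 + ‖η‖) ^ (N + n))⁻¹) * S := by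
              gcongr
              · exact hC η hη
              · exact SchwartzMap.norm_le_seminorm ℂ f _
          _ = C * S * (((1 + ‖η‖) ^ N)⁻¹ * ((1 + ‖η‖) ^ n)⁻¹) := by
              rw [pow_add, mul_inv]; ring
          _ ≤ C * S * ((c⁻¹ * opNorm h) ^ N * ((1 + ‖η‖) ^ n)⁻¹) := by gcongr
          _ = _ := by rw [mul_pow]; ring
    refine (norm_integral_le_of_norm_le (hn.const_mul _) (.of_forall hpt)).trans (le_of_eq ?_)
    rw [integral_const_mul]
    ring

/-- Away from the center, wavelets are rapidly small. -/
theorem rapidlySmall_conjS_quasiRegular_sub {φ : 𝓢(Euc d, ℂ)} {x : Euc d} {ε : ℝ} (hε : 0 < ε)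
    [Nontrivial (Euc d)]
    (hφ : ∀ y, ‖y - x‖ < 2 * ε → φ y = 1) {K : Set (MatGL d)} {m : ℕ} {A B : ℝ}
    (hK : NormBounds K m A B) (ψ : 𝓢(Euc d, ℂ)) :
    RapidlySmall {i : Euc d × MatGL d | ‖i.1 - x‖ < ε ∧ i.2 ∈ K} (fun i => opNorm i.2)
      (fun i => conjS (quasiRegular i.1 i.2 ψ) -
        SchwartzMap.smulLeftCLM ℂ φ (conjS (quasiRegular i.1 i.2 ψ))) := by
  set s := {i : Euc d × MatGL d | ‖i.1 - x‖ < ε ∧ i.2 ∈ K} with hs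
  have ht : ∀ i ∈ s, 0 < opNorm i.2 := fun i _ => opNorm_pos _
  -- Recentre at `y`: the wavelet becomes a dilate at the origin and the cutoff moves instead. As `φ
  -- = 1` on the ball of radius `2ε` about `x` and `‖y - x‖ < ε`, the factor `1 - φ(z + y)` vanishes
  -- for `‖z‖ < ε`, uniformly in `y`.
  let φ' : Euc d × MatGL d → 𝓢(Euc d, ℂ) := fun i => SchwartzMap.compSubConstCLM ℂ (-i.1) φ
  let G : Euc d × MatGL d → 𝓢(Euc d, ℂ) := fun i => dilate i.2 (conjS ψ) -
    SchwartzMap.smulLeftCLM ℂ (φ' i) (dilate i.2 (conjS ψ))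
  have ha : BoundedDerivs s (fun i z => 1 - φ (z - -i.1)) :=
    (BoundedDerivs.const 1).sub (BoundedDerivs.comp_sub φ _)
  have hG : RapidlySmall s (fun i => opNorm i.2) G := by
    refine RapidlySmall.of_dilate (g := conjS ψ) (L := fun i => linEquiv i.2⁻¹) (T := B) hε ht
      (fun i hi => (hK _ hi.2).1) ha (fun i _ z => ?_) (fun i hi z hz => ?_) (fun i _ => ?_)
      (m := m) (A := A) (fun i hi => (hK _ hi.2).2)
    · simp only [G, sub_apply]
      rw [SchwartzMap.smulLeftCLM_apply_apply (φ' i).hasTemperateGrowth]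
      simp only [φ', SchwartzMap.compSubConstCLM_apply, dilate_apply, smul_eq_mul]
      ring
    · rw [hφ, sub_self]
      have : z - -i.1 - x = z + (i.1 - x) := by abel
      rw [this]
      linarith [norm_add_le z (i.1 - x), hi.1]
    · rw [linEquiv_symm, inv_inv]
      exact le_rfl
  have hG2 := hG.translate ht (fun i => i.1) 0 (B := 1 + (‖x‖ + ε)) (fun i hi => by
    rw [pow_zero, mul_one]
    have := norm_le_norm_add_norm_sub' i.1 x
    have h1 : ‖i.1 - x‖ < ε := hi.1
    linarith)
  obtain ⟨C, hC⟩ := hK.exists_rpow_absDet_mul_le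
  have hG3 := hG2.smul ht (fun i => ((absDet i.2 ^ (-(1 / 2) : ℝ) : ℝ) : ℂ)) (m * d) (B := C)
    (fun i hi => by
      rw [Complex.norm_real, Real.norm_of_nonneg (by positivity)]
      exact hC _ hi.2)
  convert hG3 using 2 with i
  ext z
  have hφt := φ.hasTemperateGrowth
  rw [conjS_quasiRegular]
  simp only [G, sub_apply, smul_apply, SchwartzMap.compSubConstCLM_apply]
  rw [SchwartzMap.smulLeftCLM_apply_apply hφt,
    SchwartzMap.smulLeftCLM_apply_apply (φ' i).hasTemperateGrowth]
  simp only [φ', smul_apply, SchwartzMap.compSubConstCLM_apply, dilate_apply, smul_eq_mul,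
    sub_neg_eq_add, sub_add_cancel]
  ring

theorem RegularDirectedPoint.waveletTransform_decay {H : Subgroup (MatGL d)} {O V : Set (Euc d)}
    {ξ : Euc d} [Nontrivial (Euc d)] (hO : IsOpen O) (hξO : ξ ∈ O)
    (hcone : ConeApproximation H O V ξ) (hinv : InverseNormEstimate H O V ξ) {c M : ℝ} (hc : 0 < c)
    (hVc : ∀ v ∈ V, c ≤ ‖v‖) (hVM : ∀ v ∈ V, ‖v‖ ≤ M) {ψ : 𝓢(Euc d, ℂ)}
    (hψ : ∀ η, 𝓕 ψ η ≠ 0 → η ∈ V) {u : 𝓢'(Euc d, ℂ)} {x : Euc d}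
    (hreg : RegularDirectedPoint u x ξ) :
    ∃ U ∈ 𝓝 x, ∃ R : ℝ, 0 < R ∧ ∃ W : Set (Euc d), IsDirNhd ξ W ∧ W ⊆ O ∧
      ∀ N : ℕ, ∃ C : ℝ, 0 < C ∧ ∀ y ∈ U, ∀ h ∈ outerK H W V R,
        ‖waveletTransform ψ u y (h : MatGL d)‖ ≤ C * opNorm (h : MatGL d) ^ N := by
  obtain ⟨φ₀, hφs, hφc, hφ1, F, hF, W, hW, hdec⟩ := hreg
  set φ : 𝓢(Euc d, ℂ) := hφc.toSchwartzMap hφs with hφdef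
  have hφcoe : (φ : Euc d → ℂ) = φ₀ := rfl
  obtain ⟨ε, hε, hεφ⟩ : ∃ ε : ℝ, 0 < ε ∧ ∀ y, ‖y - x‖ < 2 * ε → φ y = 1 := by
    obtain ⟨δ, hδ, hball⟩ := Metric.eventually_nhds_iff.mp hφ1
    refine ⟨δ / 2, by positivity, fun y hy => hball ?_⟩
    rw [dist_eq_norm]
    linarith
  -- The neighborhood of a regular directed point need not lie in `O`, so it is cut down first. The
  -- radius `1` is arbitrary; only membership in the cone is used.
  obtain ⟨R', hR', W', hW', hW'O, hsub⟩ := hcone (W ∩ (O ∩ Metric.sphere 0 1))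
    (hW.inter ⟨⟨hξO, (hW.2.choose_spec.2 ▸ hW.1).2⟩, O, hO, rfl⟩)
    (fun η hη => hη.2.1) 1 one_pos
  obtain ⟨W₀, hW₀, -, R₀, hR₀, m, A, B, hbd⟩ := hinv.exists_bounds hVM
  refine ⟨Metric.ball x ε, Metric.ball_mem_nhds x hε, max R' R₀, lt_max_of_lt_left hR', W' ∩ W₀,
    hW'.inter hW₀, fun η hη => hW'O hη.1, fun N => ?_⟩
  set K : Set (MatGL d) := Subtype.val '' outerK H (W' ∩ W₀) V (max R' R₀) with hKdef
  have hK : NormBounds K m A B := by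
    rintro - ⟨h, hh, rfl⟩
    exact hbd h (outerK_mono Set.inter_subset_right (le_max_right _ _) hh)
  have hKV : ∀ h ∈ K, ∀ v ∈ V, dualAct h⁻¹ v ∈ cone W := by
    rintro - ⟨h, hh, rfl⟩ v hv
    exact cone_mono Set.inter_subset_left
      (hsub (outerK_mono Set.inter_subset_left (le_max_left _ _) hh) ⟨v, hv, rfl⟩).1
  obtain ⟨C₁, hC₁, h₁⟩ := exists_waveletTransform_le_of_decay hF hdec hc hVc
    (fun h hh => (hK h hh).1) hKV hψ N
  obtain ⟨C₂, hC₂, h₂⟩ := (rapidlySmall_conjS_quasiRegular_sub hε hεφ hK ψ).distribution u N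
  refine ⟨C₁ + C₂ + 1, by positivity, fun y hy h hh => ?_⟩
  have hhK : (h : MatGL d) ∈ K := ⟨h, hh, rfl⟩
  have e1 := h₁ y h hhK
  have e2 := h₂ (y, (h : MatGL d)) ⟨by simpa [dist_eq_norm] using hy, hhK⟩
  have e3 : waveletTransform ψ u y (h : MatGL d) =
      waveletTransform ψ (TemperedDistribution.smulLeftCLM ℂ φ₀ u) y (h : MatGL d) +
      u (conjS (quasiRegular y (h : MatGL d) ψ) -
        SchwartzMap.smulLeftCLM ℂ φ (conjS (quasiRegular y (h : MatGL d) ψ))) := by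
    rw [waveletTransform, waveletTransform, TemperedDistribution.smulLeftCLM_apply_apply, map_sub,
      hφcoe]
    ring
  rw [e3]
  have hpos : 0 ≤ opNorm (h : MatGL d) ^ N := pow_nonneg (opNorm_nonneg _) _
  refine (norm_add_le _ _).trans ((add_le_add e1 e2).trans ?_)
  simp only
  nlinarith

/-! ### Rapid decay of the wavelet transform implies regularity -/

/-- A Schwartz function is invertible, modulo cutoffs, near a point where it does not vanish. -/
theorem exists_local_inverse {f : 𝓢(Euc d, ℂ)} {v : Euc d} (hv : f v ≠ 0) :
    ∃ (G Θ : 𝓢(Euc d, ℂ)) (δ : ℝ), 0 < δ ∧ (∀ z, f z * G z = Θ z) ∧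
      ∀ z, ‖z - v‖ < δ → Θ z = 1 := by
  obtain ⟨ρ, hρ, hball⟩ := Metric.eventually_nhds_iff.mp (f.continuous.continuousAt.eventually_ne hv)
  obtain ⟨Θ, hΘc, hΘ1, hΘ0⟩ := exists_schwartz_bump v (r := ρ / 3) (R := ρ / 2) (by positivity)
    (by linarith)
  -- `f` has no zero within `ρ` of `v`, while `Θ` vanishes beyond `ρ / 2`; the two open regions of
  -- smoothness overlap.
  have hsmooth : ContDiff ℝ ∞ (fun z => Θ z * (f z)⁻¹) := by
    rw [contDiff_iff_contDiffAt]
    intro z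
    rcases lt_or_ge (dist z v) ρ with hz | hz
    · exact (Θ.contDiffAt ⊤).mul ((f.contDiffAt ⊤).inv (hball hz))
    · have hopen : {w | ρ / 2 < dist w v} ∈ 𝓝 z :=
        (isOpen_lt continuous_const (by fun_prop)).mem_nhds (show ρ / 2 < dist z v by linarith)
      refine (contDiffAt_const (c := (0 : ℂ))).congr_of_eventuallyEq ?_
      filter_upwards [hopen] with w hw
      rw [hΘ0 w (by simpa using le_of_lt hw), zero_mul]
  have hcomp : HasCompactSupport (fun z => Θ z * (f z)⁻¹) := hΘc.mul_right
  refine ⟨hcomp.toSchwartzMap hsmooth, Θ, ρ / 3, by positivity, fun z => ?_, fun z hz => ?_⟩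
  · change f z * (Θ z * (f z)⁻¹) = Θ z
    rcases lt_or_ge (dist z v) (ρ / 2) with hz | hz
    · have := hball (y := z) (by linarith)
      field_simp
    · rw [hΘ0 z (by simpa using hz), zero_mul, mul_zero]
  · exact hΘ1 z (by simpa [dist_eq_norm] using hz.le)

/-- The `L¹`-normalized dilate of `γ`, multiplied by `θ`. -/
def localKernel (θ γ : 𝓢(Euc d, ℂ)) (h : MatGL d) : 𝓢(Euc d, ℂ) :=
  (((absDet h)⁻¹ : ℝ) : ℂ) • SchwartzMap.smulLeftCLM ℂ θ (dilate h γ)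

theorem localKernel_apply (θ γ : 𝓢(Euc d, ℂ)) (h : MatGL d) (z : Euc d) :
    localKernel θ γ h z = (((absDet h)⁻¹ : ℝ) : ℂ) * (θ z * γ (linEquiv h⁻¹ z)) := by
  rw [localKernel, smul_apply, SchwartzMap.smulLeftCLM_apply_apply θ.hasTemperateGrowth,
    dilate_apply, smul_eq_mul, smul_eq_mul]

theorem norm_localKernel_le (θ γ : 𝓢(Euc d, ℂ)) (h : MatGL d) (z : Euc d) :
    ‖localKernel θ γ h z‖ ≤ (absDet h)⁻¹ * SchwartzMap.seminorm ℂ 0 0 γ * ‖θ z‖ := by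
  rw [localKernel_apply, norm_mul, norm_mul, Complex.norm_real, Real.norm_of_nonneg (by positivity),
    mul_assoc, mul_comm (‖θ z‖)]
  gcongr
  exact SchwartzMap.norm_le_seminorm ℂ γ _

theorem hasCompactSupport_dualDilate {f : 𝓢(Euc d, ℂ)} (hf : HasCompactSupport f) (h : MatGL d) :
    HasCompactSupport (dualDilate h f) :=
  hf.comp_homeomorph (dualEquiv h).toHomeomorph

/-- Translation in frequency is a modulation in space, so passing from `φ` to `η` leaves the support
(reflected) and the `L¹` norm unchanged, uniformly in `η`. -/
theorem norm_fourierInv_translate (φ : 𝓢(Euc d, ℂ)) (η y : Euc d) :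
    ‖𝓕⁻ (SchwartzMap.compSubConstCLM ℂ η (𝓕⁻ φ)) y‖ = ‖φ (-y)‖ := by
  have h1 : 𝓕⁻ (SchwartzMap.compSubConstCLM ℂ η (𝓕⁻ φ)) y = modulate η φ (-y) := by
    rw [modulate, SchwartzMap.fourierInv_coe, SchwartzMap.fourier_coe, Real.fourierInv_eq_fourier_neg]
  rw [h1, modulate_apply, norm_mul, Circle.norm_coe, one_mul]

/-- The localized part of the reproducing formula: the values of the wavelet transform near `x`
control it. -/
theorem norm_fourier_localized_le {u : 𝓢'(Euc d, ℂ)} {ψ : 𝓢(Euc d, ℂ)}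
    (hψ : HasCompactSupport (𝓕 ψ : 𝓢(Euc d, ℂ))) {φ θ γ P : 𝓢(Euc d, ℂ)} {x η : Euc d} {ε D : ℝ}
    (hD : 0 ≤ D)
    (hφ : ∀ z ∉ Metric.ball x ε, φ z = 0) (hθ : ∀ z ∉ Metric.ball 0 ε, θ z = 0) {h : MatGL d}
    (hW : ∀ y ∈ Metric.ball x (2 * ε), ‖waveletTransform ψ u y h‖ ≤ D)
    (hP : ∀ z, P z = conjS (𝓕 ψ) (dualAct h z) * 𝓕 (localKernel θ γ h) z * (𝓕⁻ φ) (z - η)) :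
    ‖(𝓕 u) P‖ ≤ D * absDet h ^ (-(1 / 2) : ℝ) * ((absDet h)⁻¹ * SchwartzMap.seminorm ℂ 0 0 γ *
      ∫ z, ‖θ z‖) * ∫ y, ‖φ y‖ := by
  set f := dualDilate h (conjS (𝓕 ψ)) with hf
  set k := localKernel θ γ h with hk
  have hfc : HasCompactSupport f := by
    refine hasCompactSupport_dualDilate ?_ h
    have e : (conjS (𝓕 ψ) : Euc d → ℂ) = starRingEnd ℂ ∘ (𝓕 ψ : 𝓢(Euc d, ℂ)) :=
      funext (conjS_apply _)
    rw [e]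
    exact hψ.comp_left (map_zero _)
  have hft := f.hasTemperateGrowth
  -- `P = f · 𝓕 k · 𝓕 β` is paired with `𝓕 u` by two uses of the pairing formula: the outer one
  -- integrates over `β` with symbol `q = f · 𝓕 k`, the inner one over a translate of `k` with
  -- symbol `f`, whose modulations give wavelet coefficients.
  set q := SchwartzMap.smulLeftCLM ℂ f (𝓕 k) with hq
  have hqz : ∀ z, q z = f z * 𝓕 k z := fun z => by
    rw [hq, SchwartzMap.smulLeftCLM_apply_apply hft, smul_eq_mul]
  have hqc : HasCompactSupport q := by
    have : (q : Euc d → ℂ) = fun z => f z * 𝓕 k z := funext hqz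
    rw [this]
    exact hfc.mul_right
  set β := 𝓕⁻ (SchwartzMap.compSubConstCLM ℂ η (𝓕⁻ φ)) with hβ
  have hβF : 𝓕 β = SchwartzMap.compSubConstCLM ℂ η (𝓕⁻ φ) := FourierTransform.fourier_fourierInv_eq _
  have hβn : ∀ y, ‖β y‖ = ‖φ (-y)‖ := norm_fourierInv_translate φ η
  have hdet := abs_det_pos h
  have hwave : ∀ z, -z ∈ Metric.ball x (2 * ε) →
      ‖(𝓕 u) (modulate z f)‖ ≤ D * absDet h ^ (-(1 / 2) : ℝ) := by
    intro z hz
    have h1 := hW _ hz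
    rw [waveletTransform_eq, neg_neg, norm_mul, Complex.norm_real,
      Real.norm_of_nonneg (by positivity)] at h1
    rw [Real.rpow_neg hdet.le, ← div_eq_mul_inv, le_div_iff₀ (by positivity), mul_comm]
    exact h1
  have hinner : ∀ y, -y ∈ Metric.ball x ε → ‖(𝓕 u) (modulate y q)‖ ≤
      D * absDet h ^ (-(1 / 2) : ℝ) * ((absDet h)⁻¹ * SchwartzMap.seminorm ℂ 0 0 γ *
      ∫ z, ‖θ z‖) := by
    intro y hy
    rw [((continuous_modulate_and_fourier_pairing (𝓕 u) f hfc).2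
      (SchwartzMap.compSubConstCLM ℂ y k) (modulate y q) fun z => by
        rw [modulate_apply, hqz, fourier_compSubConst_apply]; ring).2]
    have hbd : ∀ z, ‖(𝓕 u) (modulate z f) * SchwartzMap.compSubConstCLM ℂ y k z‖ ≤
        D * absDet h ^ (-(1 / 2) : ℝ) * ((absDet h)⁻¹ * SchwartzMap.seminorm ℂ 0 0 γ *
          ‖θ (z - y)‖) := by
      intro z
      rw [norm_mul, SchwartzMap.compSubConstCLM_apply]
      by_cases hz : z - y ∈ Metric.ball (0 : Euc d) ε
      · refine mul_le_mul (hwave z ?_) (norm_localKernel_le θ γ h _) (norm_nonneg _)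
          (by positivity)
        rw [mem_ball_iff_norm] at hy hz ⊢
        have : -z - x = (-y - x) - (z - y - 0) := by abel
        rw [this]
        linarith [norm_sub_le (-y - x) (z - y - 0)]
      · have h0 : k (z - y) = 0 := by rw [hk, localKernel_apply, hθ _ hz, zero_mul, mul_zero]
        rw [h0, norm_zero, mul_zero]
        positivity
    refine (norm_integral_le_of_norm_le
      (((θ.integrable.norm.comp_sub_right y).const_mul _).const_mul _)
      (.of_forall hbd)).trans (le_of_eq ?_)
    rw [integral_const_mul, integral_const_mul, integral_sub_right_eq_self (fun z => ‖θ z‖) y]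
  rw [((continuous_modulate_and_fourier_pairing (𝓕 u) q hqc).2 β P fun z => by
    rw [hP, hqz, hβF, SchwartzMap.compSubConstCLM_apply]; rfl).2]
  have hI : 0 ≤ ∫ z, ‖θ z‖ := integral_nonneg fun z => norm_nonneg _
  refine (norm_integral_le_of_norm_le (φ.integrable.norm.comp_neg.const_mul
    (D * absDet h ^ (-(1 / 2) : ℝ) * ((absDet h)⁻¹ * SchwartzMap.seminorm ℂ 0 0 γ * ∫ z, ‖θ z‖)))
    (.of_forall fun y => ?_)).trans (le_of_eq ?_)
  · rw [norm_mul, hβn]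
    by_cases hy : -y ∈ Metric.ball x ε
    · gcongr
      exact hinner y hy
    · rw [hφ _ hy, norm_zero, mul_zero, mul_zero]
  · rw [integral_const_mul, integral_neg_eq_self (fun y => ‖φ y‖)]

/-- Pairs of a frequency `η` and a dilation `h ∈ K` with `hᵀ η = v`. -/
def matchedPairs (K : Set (MatGL d)) (v : Euc d) : Set (Euc d × MatGL d) :=
  {i | i.2 ∈ K ∧ dualAct i.2 i.1 = v}

/-- From `η = h⁻ᵀ v` one gets `‖η‖ ≤ ‖h⁻¹‖ ‖v‖`. This is the exchange rate between powers of `1 +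
‖η‖` and powers of `1 / ‖h‖`. -/
theorem one_add_norm_mul_pow_le {K : Set (MatGL d)} {m : ℕ} {A B : ℝ} (hK : NormBounds K m A B)
    {v : Euc d} {i : Euc d × MatGL d} (hi : i ∈ matchedPairs K v) :
    (1 + ‖i.1‖) * opNorm i.2 ^ m ≤ B ^ m + A * ‖v‖ := by
  have h0 := opNorm_nonneg i.2
  have h1 := norm_dualAct_le i.2⁻¹ (dualAct i.2 i.1)
  rw [dualAct_inv_dualAct, hi.2] at h1
  calc (1 + ‖i.1‖) * opNorm i.2 ^ m
      ≤ (1 + opNorm i.2⁻¹ * ‖v‖) * opNorm i.2 ^ m := by gcongr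
    _ = opNorm i.2 ^ m + (opNorm i.2⁻¹ * opNorm i.2 ^ m) * ‖v‖ := by ring
    _ ≤ _ := by
        gcongr
        · exact (hK _ hi.1).1
        · exact (hK _ hi.1).2

theorem boundedDerivs_comp_dualAct {s : Set (Euc d × MatGL d)} {B : ℝ}
    (hB : ∀ i ∈ s, opNorm i.2 ≤ B) (f : 𝓢(Euc d, ℂ)) (v : Euc d) :
    BoundedDerivs s (fun i z => f (dualAct i.2 z + v)) := by
  have h1 := BoundedDerivs.comp_affine (s := s) f
    (fun i => (dualEquiv i.2 : Euc d →L[ℝ] Euc d)) (fun _ => v)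
    (fun i hi => (norm_dualEquiv_le i.2).trans (hB i hi))
  simpa only [ContinuousLinearEquiv.coe_coe, dualEquiv_apply] using h1

/-- For bounded `‖h‖` the multipliers `f(hᵀ ·)` and `p(· - η)` have derivatives bounded
independently of `h` and `η`. -/
theorem RapidlySmall.dualDilate_mul_translate_mul {s : Set (Euc d × MatGL d)}
    {t : Euc d × MatGL d → ℝ} {k : Euc d × MatGL d → 𝓢(Euc d, ℂ)} (hk : RapidlySmall s t k) {B : ℝ}
    (hB : ∀ i ∈ s, opNorm i.2 ≤ B) (f p : 𝓢(Euc d, ℂ)) :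
    RapidlySmall s t (fun i => SchwartzMap.smulLeftCLM ℂ (dualDilate i.2 f)
      (SchwartzMap.smulLeftCLM ℂ (SchwartzMap.compSubConstCLM ℂ i.1 p) (k i))) := by
  have h1 : RapidlySmall s t (fun i =>
      SchwartzMap.smulLeftCLM ℂ (SchwartzMap.compSubConstCLM ℂ i.1 p) (k i)) :=
    hk.mul (BoundedDerivs.comp_sub p fun i => i.1) fun i _ z => by
      rw [SchwartzMap.smulLeftCLM_apply_apply
        (SchwartzMap.compSubConstCLM ℂ i.1 p).hasTemperateGrowth, smul_eq_mul,
        SchwartzMap.compSubConstCLM_apply]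
  refine h1.mul (boundedDerivs_comp_dualAct hB f 0) fun i _ z => ?_
  rw [SchwartzMap.smulLeftCLM_apply_apply (dualDilate i.2 f).hasTemperateGrowth, smul_eq_mul,
    dualDilate_apply, add_zero]

/-! ### The two remainders: frequencies far from `η` and the kernel far from `0`. -/

section Remainders

variable {K : Set (MatGL d)} {m : ℕ} {A B : ℝ} [Nontrivial (Euc d)]

/-- The frequencies away from `η`. -/
theorem rapidlySmall_frequency_tail (hK : NormBounds K m A B) {v : Euc d} {Θ : 𝓢(Euc d, ℂ)} {δ : ℝ}
    (hδ : 0 < δ) (hΘ : ∀ z, ‖z - v‖ < δ → Θ z = 1) (p : 𝓢(Euc d, ℂ)) :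
    RapidlySmall (matchedPairs K v) (fun i => opNorm i.2)
      (fun i => SchwartzMap.compSubConstCLM ℂ i.1 p -
        SchwartzMap.smulLeftCLM ℂ (dualDilate i.2 Θ) (SchwartzMap.compSubConstCLM ℂ i.1 p)) := by
  have ht : ∀ i ∈ matchedPairs K v, 0 < opNorm i.2 := fun i _ => opNorm_pos _
  -- Moving `η` to the origin, `hᵀ(z + η) = hᵀ z + v`, so the multiplier depends on `h` only and `1
  -- - Θ` vanishes for `‖h‖ ‖z‖ < δ`. Translating back costs a power of `1 + ‖η‖`, which is
  -- polynomial in `1 / ‖h‖`.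
  let Θ' : Euc d × MatGL d → 𝓢(Euc d, ℂ) := fun i =>
    dualDilate i.2 (SchwartzMap.compSubConstCLM ℂ (-v) Θ)
  have ha : BoundedDerivs (matchedPairs K v) (fun i z => 1 - Θ (dualAct i.2 z + v)) :=
    (BoundedDerivs.const 1).sub (boundedDerivs_comp_dualAct (fun i hi => (hK _ hi.1).1) Θ v)
  have h1 : RapidlySmall (matchedPairs K v) (fun i => opNorm i.2)
      (fun i => p - SchwartzMap.smulLeftCLM ℂ (Θ' i) p) := by
    refine RapidlySmall.of_vanish (g := p) hδ ht ha (fun i _ z => ?_) (fun i _ z hz => ?_)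
    · rw [sub_apply, SchwartzMap.smulLeftCLM_apply_apply (Θ' i).hasTemperateGrowth]
      simp only [Θ', dualDilate_apply, SchwartzMap.compSubConstCLM_apply, sub_neg_eq_add,
        smul_eq_mul]
      ring
    · rw [hΘ, sub_self]
      rw [add_sub_cancel_right]
      exact (norm_dualAct_le _ _).trans_lt hz
  refine (h1.translate ht (fun i => i.1) m
    (fun i hi => one_add_norm_mul_pow_le hK hi)).congr fun i hi => ?_
  ext z
  rw [SchwartzMap.compSubConstCLM_apply, sub_apply, sub_apply,
    SchwartzMap.smulLeftCLM_apply_apply (Θ' i).hasTemperateGrowth,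
    SchwartzMap.smulLeftCLM_apply_apply (dualDilate i.2 Θ).hasTemperateGrowth,
    SchwartzMap.compSubConstCLM_apply, dualDilate_apply]
  simp only [dualDilate_apply, SchwartzMap.compSubConstCLM_apply]
  rw [dualAct_sub, hi.2, sub_neg_eq_add, sub_add_cancel]

/-- The kernel away from the origin. -/
theorem rapidlySmall_kernel_tail (hK : NormBounds K m A B) {v : Euc d} {θ : 𝓢(Euc d, ℂ)} {δ : ℝ}
    (hδ : 0 < δ) (hθ : ∀ z, ‖z‖ < δ → θ z = 1) (γ : 𝓢(Euc d, ℂ)) :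
    RapidlySmall (matchedPairs K v) (fun i => opNorm i.2)
      (fun i => (((absDet i.2)⁻¹ : ℝ) : ℂ) • dilate i.2 γ - localKernel θ γ i.2) := by
  have ht : ∀ i ∈ matchedPairs K v, 0 < opNorm i.2 := fun i _ => opNorm_pos _
  have ha : BoundedDerivs (matchedPairs K v) (fun _ z => 1 - θ (z - 0)) :=
    (BoundedDerivs.const 1).sub (BoundedDerivs.comp_sub θ fun _ => 0)
  have h1 : RapidlySmall (matchedPairs K v) (fun i => opNorm i.2)
      (fun i => dilate i.2 γ - SchwartzMap.smulLeftCLM ℂ θ (dilate i.2 γ)) := by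
    refine RapidlySmall.of_dilate (g := γ) (L := fun i => linEquiv i.2⁻¹) (T := B) hδ ht
      (fun i hi => (hK _ hi.1).1) ha (fun i _ z => ?_) (fun i hi z hz => ?_) (fun i _ => ?_)
      (m := m) (A := A) (fun i hi => (hK _ hi.1).2)
    · rw [sub_apply, SchwartzMap.smulLeftCLM_apply_apply θ.hasTemperateGrowth, dilate_apply,
        smul_eq_mul, sub_zero]
      ring
    · rw [sub_zero, hθ z hz, sub_self]
    · rw [linEquiv_symm, inv_inv]
      exact le_rfl
  obtain ⟨C, hC⟩ := hK.exists_inv_absDet_mul_le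
  have h2 := h1.smul ht (fun i => (((absDet i.2)⁻¹ : ℝ) : ℂ)) (m * d) (B := C)
    (fun i hi => by
      rw [Complex.norm_real, Real.norm_of_nonneg (by positivity)]
      exact hC _ hi.1)
  simpa only [localKernel, smul_sub] using h2

end Remainders

theorem exists_norm_modulate_le {u : 𝓢'(Euc d, ℂ)} {ψ : 𝓢(Euc d, ℂ)} [Nontrivial (Euc d)]
    (hψ : HasCompactSupport (𝓕 ψ : 𝓢(Euc d, ℂ))) {φ : 𝓢(Euc d, ℂ)} {x v : Euc d} {ε : ℝ}
    (hε : 0 < ε) (hφ : ∀ z ∉ Metric.ball x ε, φ z = 0) (hv : 𝓕 ψ v ≠ 0) {K : Set (MatGL d)}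
    {m : ℕ} {A B : ℝ} (hK : NormBounds K m A B)
    (hW : ∀ N : ℕ, ∃ C : ℝ, 0 < C ∧ ∀ y ∈ Metric.ball x (2 * ε), ∀ h ∈ K,
      ‖waveletTransform ψ u y h‖ ≤ C * opNorm h ^ N) (N : ℕ) :
    ∃ C : ℝ, 0 ≤ C ∧ ∀ i ∈ matchedPairs K v, ‖u (modulate i.1 φ)‖ ≤ C * opNorm i.2 ^ N := by
  set f := conjS (𝓕 ψ) with hf
  obtain ⟨G, Θ, δ, hδ, hG, hΘ⟩ := exists_local_inverse (f := f) (v := v) (by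
    rw [hf, conjS_apply]
    simpa using hv)
  obtain ⟨θ, -, hθ1, hθ0⟩ := exists_schwartz_bump (0 : Euc d) (half_pos hε) (half_lt_self hε)
  set p := 𝓕⁻ φ with hp
  set γ := 𝓕⁻ G with hγ
  have hγF : 𝓕 γ = G := FourierTransform.fourier_fourierInv_eq G
  set s := matchedPairs K v with hs
  let τ : Euc d × MatGL d → 𝓢(Euc d, ℂ) := fun i => SchwartzMap.compSubConstCLM ℂ i.1 p
  have hτz : ∀ i z, τ i z = p (z - i.1) := fun i z => SchwartzMap.compSubConstCLM_apply p i.1 z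
  have htail := rapidlySmall_frequency_tail hK hδ hΘ p
  have hker := rapidlySmall_kernel_tail hK (v := v) (half_pos hε)
    (fun z hz => hθ1 z (by simpa using hz.le)) γ
  let k₂ : Euc d × MatGL d → 𝓢(Euc d, ℂ) := fun i =>
    (((absDet i.2)⁻¹ : ℝ) : ℂ) • dilate i.2 γ - localKernel θ γ i.2
  let Q : Euc d × MatGL d → 𝓢(Euc d, ℂ) := fun i => SchwartzMap.smulLeftCLM ℂ (dualDilate i.2 f)
    (SchwartzMap.smulLeftCLM ℂ (τ i) (𝓕 (k₂ i)))
  have hQz : ∀ i z, Q i z = f (dualAct i.2 z) * p (z - i.1) * 𝓕 (k₂ i) z := fun i z => by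
    simp only [Q]
    rw [SchwartzMap.smulLeftCLM_apply_apply (dualDilate i.2 f).hasTemperateGrowth,
      SchwartzMap.smulLeftCLM_apply_apply (τ i).hasTemperateGrowth, smul_eq_mul, smul_eq_mul,
      dualDilate_apply, mul_assoc, hτz]
  have hQ : RapidlySmall s (fun i => opNorm i.2) Q :=
    (hker.clm (FourierTransform.fourierCLM ℂ 𝓢(Euc d, ℂ))).dualDilate_mul_translate_mul
      (fun i hi => (hK _ hi.1).1) f p
  let P : Euc d × MatGL d → 𝓢(Euc d, ℂ) := fun i => SchwartzMap.smulLeftCLM ℂ (dualDilate i.2 f)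
    (SchwartzMap.smulLeftCLM ℂ (τ i) (𝓕 (localKernel θ γ i.2)))
  have hPz : ∀ i z, P i z = f (dualAct i.2 z) * 𝓕 (localKernel θ γ i.2) z * p (z - i.1) :=
    fun i z => by
    simp only [P]
    rw [SchwartzMap.smulLeftCLM_apply_apply (dualDilate i.2 f).hasTemperateGrowth,
      SchwartzMap.smulLeftCLM_apply_apply (τ i).hasTemperateGrowth, smul_eq_mul, smul_eq_mul,
      dualDilate_apply, mul_assoc, mul_comm (𝓕 (localKernel θ γ i.2) z), hτz]
  -- Main part, kernel tail and frequency tail. The sum `P + Q` equals `f(hᵀ ·) G(hᵀ ·) τ = Θ(hᵀ ·)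
  -- τ`, because the two kernels add up to the full dilate of `γ`, whose Fourier transform is `G(hᵀ
  -- ·)`.
  have hdecomp : ∀ i, τ i = P i + Q i +
      (τ i - SchwartzMap.smulLeftCLM ℂ (dualDilate i.2 Θ) (τ i)) := by
    intro i
    ext z
    have hdet : (absDet i.2 : ℂ) ≠ 0 := by exact_mod_cast (abs_det_pos i.2).ne'
    have hk : 𝓕 (k₂ i) z + 𝓕 (localKernel θ γ i.2) z = G (dualAct i.2 z) := by
      rw [← add_apply, ← FourierTransform.fourier_add]
      simp only [k₂]
      rw [sub_add_cancel, FourierTransform.fourier_smul, smul_apply, fourier_dilate_apply, hγF,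
        smul_eq_mul, ← mul_assoc, Complex.ofReal_inv, inv_mul_cancel₀ hdet, one_mul]
    rw [add_apply, add_apply, sub_apply, hPz, hQz,
      SchwartzMap.smulLeftCLM_apply_apply (dualDilate i.2 Θ).hasTemperateGrowth, dualDilate_apply,
      smul_eq_mul, ← hG, ← hk]
    rw [hτz]
    ring
  obtain ⟨C₁, hC₁, h₁⟩ := hQ.distribution (𝓕 u) N
  obtain ⟨C₂, hC₂, h₂⟩ := htail.distribution (𝓕 u) N
  -- One extra `m * d` absorbs `|det h| ^ (-1/2)` from the wavelet normalization, the other `|det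
  -- h|⁻¹` from the kernel.
  obtain ⟨C₃, hC₃, h₃⟩ := hW (N + m * d + m * d)
  obtain ⟨C₄, h₄⟩ := hK.exists_inv_absDet_mul_le
  obtain ⟨C₅, h₅⟩ := hK.exists_rpow_absDet_mul_le
  set S := SchwartzMap.seminorm ℂ 0 0 γ with hS
  set I := ∫ z, ‖θ z‖ with hI
  set J := ∫ z, ‖φ z‖ with hJ
  have hS0 : 0 ≤ S := apply_nonneg _ _
  have hI0 : 0 ≤ I := integral_nonneg fun z => norm_nonneg _
  have hJ0 : 0 ≤ J := integral_nonneg fun z => norm_nonneg _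
  refine ⟨C₃ * max C₅ 0 * (max C₄ 0 * S * I) * J + C₁ + C₂, by positivity, fun i hi => ?_⟩
  have hti := opNorm_pos i.2
  have h6 : ‖(𝓕 u) (P i)‖ ≤ C₃ * max C₅ 0 * (max C₄ 0 * S * I) * J * opNorm i.2 ^ N := by
    refine (norm_fourier_localized_le hψ (by positivity) hφ hθ0
      (fun y hy => h₃ y hy i.2 hi.1) (hPz i)).trans ?_
    have h7 := (h₄ i.2 hi.1).trans (le_max_left C₄ 0)
    have h8 := (h₅ i.2 hi.1).trans (le_max_left C₅ 0)
    have hdet := abs_det_pos i.2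
    calc C₃ * opNorm i.2 ^ (N + m * d + m * d) * absDet i.2 ^ (-(1 / 2) : ℝ) *
          ((absDet i.2)⁻¹ * S * I) * J
        = C₃ * (absDet i.2 ^ (-(1 / 2) : ℝ) * opNorm i.2 ^ (m * d)) *
          (((absDet i.2)⁻¹ * opNorm i.2 ^ (m * d)) * S * I) * J * opNorm i.2 ^ N := by
          rw [pow_add, pow_add]; ring
      _ ≤ _ := by gcongr
  have h9 : u (modulate i.1 φ) = (𝓕 u) (τ i) := rfl
  rw [h9, hdecomp i, map_add, map_add]
  refine (norm_add₃_le).trans ?_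
  have := h₁ i hi
  have := h₂ i hi
  simp only [add_mul]
  gcongr

/-- The Fourier transform of `φ u`, for a compactly supported Schwartz function `φ`. -/
theorem isContinuousFunction_fourier_smulLeftCLM (u : 𝓢'(Euc d, ℂ)) {φ : 𝓢(Euc d, ℂ)}
    (hφ : HasCompactSupport φ) :
    IsContinuousFunction (𝓕 (TemperedDistribution.smulLeftCLM ℂ φ u))
      (fun η => u (modulate η φ)) := by
  have h := continuous_modulate_and_fourier_pairing u φ hφ
  refine ⟨h.1, fun g => ?_⟩
  have hg := h.2 g (SchwartzMap.smulLeftCLM ℂ φ (𝓕 g)) fun z => by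
    rw [SchwartzMap.smulLeftCLM_apply_apply φ.hasTemperateGrowth, smul_eq_mul]
  refine ⟨hg.1, ?_⟩
  rw [TemperedDistribution.fourier_apply, TemperedDistribution.smulLeftCLM_apply_apply, hg.2]

/-- Any `h ∈ H` with `hᵀ η = v` has `η ∈ h⁻ᵀ V`, so it lies in the outer set as soon as `η` is in
the truncated cone; decay at this single `h` bounds the value at `η`. -/
theorem regularDirectedPoint_of_waveletTransform_decay {H : Subgroup (MatGL d)} {ξ₀ : Euc d}
    {V : Set (Euc d)} {ξ v : Euc d} [Nontrivial (Euc d)] (hopen : IsOpen (dualOrbit H ξ₀))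
    (hinv : InverseNormEstimate H (dualOrbit H ξ₀) V ξ) {M : ℝ} (hVM : ∀ v ∈ V, ‖v‖ ≤ M)
    {ψ : 𝓢(Euc d, ℂ)} (hψ : HasCompactSupport (𝓕 ψ : 𝓢(Euc d, ℂ))) (hvV : v ∈ V)
    (hvO : v ∈ dualOrbit H ξ₀) (hv : 𝓕 ψ v ≠ 0) {u : 𝓢'(Euc d, ℂ)} {x : Euc d}
    (hdec : ∃ U ∈ 𝓝 x, ∃ R : ℝ, 0 < R ∧ ∃ W : Set (Euc d), IsDirNhd ξ W ∧ W ⊆ dualOrbit H ξ₀ ∧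
      ∀ N : ℕ, ∃ C : ℝ, 0 < C ∧ ∀ y ∈ U, ∀ h ∈ outerK H W V R,
        ‖waveletTransform ψ u y (h : MatGL d)‖ ≤ C * opNorm (h : MatGL d) ^ N) :
    RegularDirectedPoint u x ξ := by
  obtain ⟨U, hU, R, hR, W, hW, hWO, hdec⟩ := hdec
  obtain ⟨W₀, hW₀, -, R₀, hR₀, m, A, B, hbd⟩ := hinv.exists_bounds hVM
  obtain ⟨δ, hδ, hball⟩ := Metric.mem_nhds_iff.mp hU
  set ε := δ / 2 with hε
  have hε0 : 0 < ε := by positivity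
  have h2ε : 2 * ε = δ := by rw [hε]; ring
  obtain ⟨φ, hφc, hφ1, hφ0⟩ := exists_schwartz_bump x (half_pos hε0) (half_lt_self hε0)
  set K : Set (MatGL d) := Subtype.val '' outerK H (W ∩ W₀) V (max R R₀) with hKdef
  have hK : NormBounds K m A B := by
    rintro - ⟨h, hh, rfl⟩
    exact hbd h (outerK_mono Set.inter_subset_right (le_max_right _ _) hh)
  have hWK : ∀ N : ℕ, ∃ C : ℝ, 0 < C ∧ ∀ y ∈ Metric.ball x (2 * ε), ∀ h ∈ K,
      ‖waveletTransform ψ u y h‖ ≤ C * opNorm h ^ N := by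
    intro N
    obtain ⟨C, hC0, hC⟩ := hdec N
    refine ⟨C, hC0, ?_⟩
    rintro y hy - ⟨h, hh, rfl⟩
    exact hC y (hball (h2ε ▸ hy)) h (outerK_mono Set.inter_subset_left (le_max_left _ _) hh)
  have hF := isContinuousFunction_fourier_smulLeftCLM u hφc
  refine ⟨φ, φ.smooth ⊤, hφc, ?_, _, hF, W ∩ W₀, hW.inter hW₀, fun N => ?_⟩
  · filter_upwards [Metric.closedBall_mem_nhds x (half_pos hε0)] with y hy using hφ1 y hy
  -- Order `m * N` in `‖h‖` is what `N` factors `1 + ‖η‖ ≤ D ‖h‖ ^ (-m)` consume.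
  obtain ⟨C₁, hC₁, h₁⟩ := exists_norm_modulate_le hψ hε0 hφ0 hv hK hWK (m * N)
  obtain ⟨C₂, h₂⟩ := (isCompact_closedBall (0 : Euc d) (max R R₀)).exists_bound_of_continuousOn
    hF.1.continuousOn
  set D := B ^ m + A * ‖v‖ with hD
  refine ⟨C₁ * |D| ^ N + |C₂| * (1 + max R R₀) ^ N + 1, by positivity, fun η hη => ?_⟩
  rw [← div_eq_mul_inv, le_div_iff₀ (by positivity)]
  have hR0 : 0 ≤ |C₂| * (1 + max R R₀) ^ N := by positivity
  have hD0 : 0 ≤ C₁ * |D| ^ N := by positivity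
  -- Frequencies below the truncation radius are handled by continuity on a compact ball.
  rcases le_or_gt ‖η‖ (max R R₀) with hle | hlt
  · have h3 := h₂ η (by simpa using hle)
    calc ‖u (modulate η φ)‖ * (1 + ‖η‖) ^ N ≤ |C₂| * (1 + max R R₀) ^ N := by
          gcongr
          exact h3.trans (le_abs_self _)
      _ ≤ _ := by linarith
  · have hηO : η ∈ dualOrbit H ξ₀ :=
      cone_subset_dualOrbit hopen (fun _ hs => hWO hs.1) hη
    obtain ⟨h, hh, hηv⟩ := exists_dualAct_eq hηO hvO
    have hηv' : dualAct h⁻¹ v = η := by rw [← hηv, dualAct_inv_dualAct]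
    have hmem : (⟨h, hh⟩ : H) ∈ outerK H (W ∩ W₀) V (max R R₀) :=
      mem_outerK hvV (by simpa only [hηv'] using hη) (by simpa only [hηv'] using hlt)
    have hi : (η, h) ∈ matchedPairs K v := ⟨⟨_, hmem, rfl⟩, hηv⟩
    have h3 := h₁ _ hi
    have h4 := (one_add_norm_mul_pow_le hK hi).trans (le_abs_self _)
    have h5 := opNorm_nonneg h
    simp only at h3 h4
    calc ‖u (modulate η φ)‖ * (1 + ‖η‖) ^ N ≤ (C₁ * opNorm h ^ (m * N)) * (1 + ‖η‖) ^ N := by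
          gcongr
      _ = C₁ * ((1 + ‖η‖) * opNorm h ^ m) ^ N := by rw [pow_mul, mul_pow]; ring
      _ ≤ C₁ * |D| ^ N := by gcongr
      _ ≤ _ := by linarith

end DilationWavelet

end

/-! ### The equivalence. -/

theorem mainTheorem4 {d : ℕ}
    (H : Subgroup (DilationWavelet.MatGL d))
    (hH : IsClosed (H : Set (DilationWavelet.MatGL d)))
    [MeasurableSpace H] [BorelSpace H]
    (μ : MeasureTheory.Measure H) [μ.IsHaarMeasure]
    (ξ₀ : DilationWavelet.Euc d) (O : Set (DilationWavelet.Euc d))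
    (hO : O = DilationWavelet.dualOrbit H ξ₀)
    (hO_open : IsOpen O)
    (hstab : IsCompact (DilationWavelet.dualStabilizer H ξ₀))
    (V : Set (DilationWavelet.Euc d)) (hV_nonempty : V.Nonempty)
    (hV : DilationWavelet.CompactlyInside V O)
    (ξ₁ : DilationWavelet.Euc d) (hξ₁ : ξ₁ ∈ O ∩ Metric.sphere 0 1)
    (hcone : DilationWavelet.ConeApproximation H O V ξ₁)
    (hinv : DilationWavelet.InverseNormEstimate H O V ξ₁) :
    ∀ ψ : SchwartzMap (DilationWavelet.Euc d) ℂ,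
      DilationWavelet.Admissible H μ O ψ →
      tsupport (FourierTransform.fourier ψ : SchwartzMap (DilationWavelet.Euc d) ℂ) ⊆ V →
      ∀ (u : TemperedDistribution (DilationWavelet.Euc d) ℂ)
        (x ξ : DilationWavelet.Euc d), ξ ∈ O ∩ Metric.sphere 0 1 →
        (DilationWavelet.RegularDirectedPoint u x ξ ↔
          ∃ U ∈ nhds x, ∃ R : ℝ, 0 < R ∧
            ∃ W : Set (DilationWavelet.Euc d), DilationWavelet.IsDirNhd ξ W ∧ W ⊆ O ∧
              ∀ N : ℕ, ∃ C : ℝ, 0 < C ∧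
                ∀ y ∈ U, ∀ h ∈ DilationWavelet.outerK H W V R,
                  ‖DilationWavelet.waveletTransform ψ u y (h : DilationWavelet.MatGL d)‖ ≤
                    C * DilationWavelet.opNorm (h : DilationWavelet.MatGL d) ^ N) := by
  intro ψ hadm hsupp u x ξ hξ
  subst hO
  have hξ₁0 : ξ₁ ≠ 0 := by
    rintro rfl
    simpa using hξ₁.2
  have : Nontrivial (DilationWavelet.Euc d) := ⟨⟨ξ₁, 0, hξ₁0⟩⟩
  have hzero := DilationWavelet.zero_notMem_dualOrbit hξ₁.1 hξ₁0
  obtain ⟨-, -, hVc, hVO⟩ := hV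
  obtain ⟨M, hM⟩ := hVc.isBounded.exists_norm_le
  have hVM : ∀ v ∈ V, ‖v‖ ≤ M := fun v hv => hM v (subset_closure hv)
  -- The compact closure of `V` lies in an orbit that omits `0`, so the norm has a positive minimum
  -- on it.
  obtain ⟨c, hc, hcV⟩ : ∃ c : ℝ, 0 < c ∧ ∀ v ∈ V, c ≤ ‖v‖ := by
    obtain ⟨w, hw, hmin⟩ := hVc.exists_isMinOn hV_nonempty.closure continuous_norm.continuousOn
    refine ⟨‖w‖, norm_pos_iff.mpr fun h0 => hzero (h0 ▸ hVO hw), fun v hv => ?_⟩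
    exact hmin (subset_closure hv)
  have hcone' := hcone.transfer hO_open hξ₁ hξ
  have hinv' := hinv.transfer hO_open hξ₁ hξ
  have hψV : ∀ η, (FourierTransform.fourier ψ : SchwartzMap (DilationWavelet.Euc d) ℂ) η ≠ 0 →
      η ∈ V := fun η hη => hsupp (subset_tsupport _ hη)
  refine ⟨fun hreg => hreg.waveletTransform_decay hO_open hξ.1 hcone' hinv' hc hcV hVM hψV,
    fun hdec => ?_⟩
  -- If `ψ̂` vanished on the orbit, the admissibility integral would be `0` instead of `1`.
  obtain ⟨v, hvO, hv⟩ : ∃ v ∈ DilationWavelet.dualOrbit H ξ₀,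
      (FourierTransform.fourier ψ : SchwartzMap (DilationWavelet.Euc d) ℂ) v ≠ 0 := by
    by_contra! hcon
    have h1 := hadm ξ₁ hξ₁.1
    have h2 : ∀ h : H, ‖(FourierTransform.fourier ψ : SchwartzMap (DilationWavelet.Euc d) ℂ)
        (DilationWavelet.dualAct (h : DilationWavelet.MatGL d) ξ₁)‖ ^ 2 = 0 := fun h => by
      rw [hcon _ (DilationWavelet.dualAct_mem_dualOrbit h.2 hξ₁.1)]
      simp
    simp [h2] at h1
  have hcs : HasCompactSupport
      (FourierTransform.fourier ψ : SchwartzMap (DilationWavelet.Euc d) ℂ) :=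
    hVc.of_isClosed_subset (isClosed_tsupport _) (hsupp.trans subset_closure)
  exact DilationWavelet.regularDirectedPoint_of_waveletTransform_decay hO_open hinv' hVM hcs
    (hψV v hv) hvO hv hdec
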